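/- An ordered graph is a finite simple graph whose vertex set is linearly ordered. An ordered graph $H$ contains an ordered graph $G$ if some (not necessarily induced) subgraph of $H$ is order isomorphic to $G$; otherwise $H$ avoids $G$. Let $\mathrm{ex}_<(n,G)$ be the maximum number of edges of an ordered graph on $n$ vertices that avoids $G$ (with the maximum of the empty set read as $0$). Call $G$ minimally non-linear if $\mathrm{ex}_<(n,G)=\omega(n)$, but $\mathrm{ex}_<(n,G')=O(n)$ for every ordered graph $G'$ that is strictly contained in $G$ (contained in $G$ and not order isomorphic to $G$). Theorem. Let $G$ be a minimally non-linear ordered graph that is bipartite with parts $U$ and $V$; that is, the vertex set of $G$ is the disjoint union of $U$ and $V$, and every edge of $G$ joins a vertex of $U$ to a vertex of $V$. The parts may be interleaved in the vertex order. If $G$ is disconnected, so that its bipartition is not unique, assume that the parts are chosen so that no vertex of $U$ lies, in the vertex order, between two vertices of $V$ that are consecutive in $V$ and have a common neighbour (this holds, for instance, if all vertices of one part precede all vertices of the other). If $|U|=k$, then $|V|\le 4k-2$. -/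

import Mathlib

open Filter Asymptotics

/-- An ordered graph is a simple graph on a linearly ordered vertex set. The ordered graph `H`
contains `G` if some (not necessarily induced) subgraph of `H` is order isomorphic to `G`:
there is an order embedding of the vertices of `G` that maps edges of `G` to edges of `H`. -/
def OrderedContains {β α : Type*} [LinearOrder β] [LinearOrder α]
    (H : SimpleGraph β) (G : SimpleGraph α) : Prop :=
  ∃ f : α ↪o β, ∀ a b : α, G.Adj a b → H.Adj (f a) (f b)

/-- `H` avoids `G`. -/
def OrderedAvoids {β α : Type*} [LinearOrder β] [LinearOrder α]
    (H : SimpleGraph β) (G : SimpleGraph α) : Prop :=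
  ¬ OrderedContains H G

/-- The extremal function: the maximum number of edges of an ordered graph on `n` vertices that
avoids `G` (equal to `0` if no ordered graph on `n` vertices avoids `G`, which can only happen
when `G` has no edge). -/
noncomputable def orderedEx {α : Type*} [LinearOrder α] (n : ℕ) (G : SimpleGraph α) : ℕ :=
  sSup {e : ℕ | ∃ H : SimpleGraph (Fin n), OrderedAvoids H G ∧ H.edgeSet.ncard = e}

/-- The set over which the supremum in `orderedEx` is taken is bounded, so that the supremum is a
maximum whenever some ordered graph on `n` vertices avoids `G`. -/
theorem bddAbove_orderedEx {α : Type*} [LinearOrder α] (n : ℕ) (G : SimpleGraph α) :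
    BddAbove {e : ℕ | ∃ H : SimpleGraph (Fin n), OrderedAvoids H G ∧ H.edgeSet.ncard = e} := by
  refine ((Set.finite_range fun H : SimpleGraph (Fin n) => H.edgeSet.ncard).subset ?_).bddAbove
  rintro e ⟨H, -, rfl⟩
  exact ⟨H, rfl⟩

/-- `G` is minimally non-linear if its extremal function is `ω(n)`, but the extremal function of
every ordered graph `G'` strictly contained in `G` is `O(n)`. Every finite ordered graph is order
isomorphic to one on some `Fin m`; and since mutually containing finite ordered graphs are order
isomorphic, strict containment means that `G` contains `G'` but `G'` does not contain `G`. -/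
def IsMinimallyNonlinear {α : Type*} [LinearOrder α] (G : SimpleGraph α) : Prop :=
  ((fun n : ℕ => (n : ℝ)) =o[atTop] fun n : ℕ => (orderedEx n G : ℝ)) ∧
  ∀ (m : ℕ) (G' : SimpleGraph (Fin m)), OrderedContains G G' → ¬ OrderedContains G' G →
    (fun n : ℕ => (orderedEx n G' : ℝ)) =O[atTop] fun n : ℕ => (n : ℝ)

/-! Read the vertices of `V`, in order, as columns, and let the letters of a column be its
neighbours in `U`. If `V` has more than `4k - 2` vertices, then `G` is too large to coincide with
any of a few small non-linear configurations, so by minimality it contains none of them: two edges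
crossing no common cut (`not_hasLinearEx_of_le`, from complete bipartite graphs), a 4-cycle
(`not_hasLinearEx_of_fourCycle`, from incidences of points and lines), and, once all edges cross one
cut, two letters alternating `a b a b` (`not_hasLinearEx_of_alternation`). The last needs matrices
of unbounded density without such an alternation; `FanMatrix.stack` builds them by a double
induction that adds one entry to some rows while keeping the number of columns comparable to the
number of rows.

Minimality also says that deleting a vertex makes `G` linear, so no vertex may be insertable at
linear cost. Hence there is no isolated vertex (`HasLinearEx.of_isolated`) and no vertex of degree
one immediately between two neighbours of its neighbour (`HasLinearEx.of_insert_between`). So every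
column has a letter, and a letter common to three consecutive columns has company in the middle one;
the assumption on the parts, automatic for connected `G`, makes consecutive columns with a common
letter consecutive vertices.

What remains is a count (`card_columns_le`): each gap between columns without a common letter, and
each column sharing letters with both its neighbours, is charged to a first or last occurrence of a
letter, and there are only `2k` of these. -/

/-! ### Linear extremal functions and minimality -/

/-- The extremal function of `G` is bounded by a linear function. -/
def HasLinearEx {α : Type*} [LinearOrder α] (G : SimpleGraph α) : Prop :=
  ∃ C : ℕ, ∀ (n : ℕ) (H : SimpleGraph (Fin n)), OrderedAvoids H G →
    H.edgeSet.ncard ≤ C * (n + 1)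

theorem OrderedContains.trans {α β γ : Type*} [LinearOrder α] [LinearOrder β] [LinearOrder γ]
    {K : SimpleGraph γ} {H : SimpleGraph β} {G : SimpleGraph α}
    (h₁ : OrderedContains K H) (h₂ : OrderedContains H G) : OrderedContains K G := by
  obtain ⟨f, hf⟩ := h₁
  obtain ⟨g, hg⟩ := h₂
  exact ⟨g.trans f, fun a b hab => hf _ _ (hg _ _ hab)⟩

theorem OrderedContains.comap {α β : Type*} [LinearOrder α] [LinearOrder β]
    (G : SimpleGraph α) (f : β ↪o α) : OrderedContains G (G.comap f) :=
  ⟨f, fun _ _ h => h⟩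

theorem OrderedContains.comap_orderIso {α β : Type*} [LinearOrder α] [LinearOrder β]
    (G : SimpleGraph α) (e : β ≃o α) : OrderedContains (G.comap e) G :=
  ⟨e.symm.toOrderEmbedding, fun a b h => by simpa using h⟩

theorem HasLinearEx.of_contains {α β : Type*} [LinearOrder α] [LinearOrder β]
    {G : SimpleGraph α} {G' : SimpleGraph β} (h : OrderedContains G G') (hG : HasLinearEx G) :
    HasLinearEx G' := by
  obtain ⟨C, hC⟩ := hG
  exact ⟨C, fun n H hH => hC n H fun hc => hH (hc.trans h)⟩

theorem ncard_edgeSet_comap_equiv {β γ : Type*} (H : SimpleGraph β) (e : γ ≃ β) :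
    (H.comap e).edgeSet.ncard = H.edgeSet.ncard := by
  have := Nat.card_congr (SimpleGraph.Iso.comap e H).mapEdgeSet
  simpa [Set.ncard] using this

/-- A linear bound on `Fin n` gives one on every finite linear order. -/
theorem HasLinearEx.exists_bound {α : Type*} [LinearOrder α] {G : SimpleGraph α}
    (hG : HasLinearEx G) : ∃ C : ℕ, ∀ (X : Type) [LinearOrder X] [Fintype X] (H : SimpleGraph X),
      OrderedAvoids H G → H.edgeSet.ncard ≤ C * (Fintype.card X + 1) := by
  obtain ⟨C, hC⟩ := hG
  refine ⟨C, fun X _ _ H hH => ?_⟩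
  let e : Fin (Fintype.card X) ≃o X := Fintype.orderIsoFinOfCardEq X rfl
  rw [← ncard_edgeSet_comap_equiv H e.toEquiv]
  exact hC _ _ fun hc => hH ((OrderedContains.comap H e.toOrderEmbedding).trans hc)

theorem ncard_edgeSet_le_sq {n : ℕ} (H : SimpleGraph (Fin n)) : H.edgeSet.ncard ≤ n * n := by
  classical
  rw [← SimpleGraph.coe_edgeFinset, Set.ncard_coe_finset]
  refine H.card_edgeFinset_le_card_choose_two.trans ?_
  rw [Fintype.card_fin, Nat.choose_two_right]
  exact (Nat.div_le_self _ _).trans (Nat.mul_le_mul_left _ (Nat.sub_le _ _))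

theorem OrderedAvoids.ncard_le_orderedEx {α : Type*} [LinearOrder α] {G : SimpleGraph α} {n : ℕ}
    {H : SimpleGraph (Fin n)} (h : OrderedAvoids H G) : H.edgeSet.ncard ≤ orderedEx n G :=
  le_csSup (bddAbove_orderedEx n G) ⟨H, h, rfl⟩

theorem HasLinearEx.of_isBigO {α : Type*} [LinearOrder α] {G : SimpleGraph α}
    (h : (fun n : ℕ => (orderedEx n G : ℝ)) =O[atTop] fun n : ℕ => (n : ℝ)) :
    HasLinearEx G := by
  obtain ⟨c, hc⟩ := h.bound
  obtain ⟨N, hN⟩ := eventually_atTop.1 hc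
  -- The term `N * N` pays for `n ≤ N`, where only the trivial quadratic bound is available.
  refine ⟨⌈c⌉₊ + N * N, fun n H hH => ?_⟩
  rcases le_total N n with hn | hn
  · have h1 := hN n hn
    simp only [Real.norm_natCast] at h1
    have h2 : (orderedEx n G : ℝ) ≤ (⌈c⌉₊ * n : ℕ) := by
      push_cast
      exact h1.trans (mul_le_mul_of_nonneg_right (Nat.le_ceil c) (Nat.cast_nonneg n))
    have h3 : orderedEx n G ≤ ⌈c⌉₊ * n := by exact_mod_cast h2
    refine (hH.ncard_le_orderedEx.trans h3).trans ?_
    exact Nat.mul_le_mul (Nat.le_add_right _ _) (Nat.le_succ _)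
  · refine (ncard_edgeSet_le_sq H).trans ((Nat.mul_le_mul hn hn).trans ?_)
    nlinarith [Nat.zero_le (⌈c⌉₊ * n), Nat.zero_le (N * N * n)]

theorem HasLinearEx.not_isLittleO {α : Type*} [LinearOrder α] {G : SimpleGraph α}
    (h : HasLinearEx G) :
    ¬ (fun n : ℕ => (n : ℝ)) =o[atTop] fun n : ℕ => (orderedEx n G : ℝ) := by
  intro ho
  obtain ⟨C, hC⟩ := h
  have hex : ∀ n, orderedEx n G ≤ C * (n + 1) := fun n => by
    refine csSup_le' ?_
    rintro e ⟨H, hH, rfl⟩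
    exact hC n H hH
  -- With this constant, little-o at `N + 1` would give `4 * (C + 1) * (N + 1) ≤ C * (N + 2)`.
  have hpos : (0 : ℝ) < 1 / (4 * (C + 1)) := by positivity
  obtain ⟨N, hN⟩ := eventually_atTop.1 (ho.bound hpos)
  have h1 := hN (N + 1) (by omega)
  simp only [Real.norm_natCast] at h1
  have h2 : (orderedEx (N + 1) G : ℝ) ≤ C * ((N + 1 : ℕ) + 1) := by exact_mod_cast hex (N + 1)
  rw [one_div, inv_mul_eq_div, le_div_iff₀ (by positivity)] at h1
  push_cast at h1 h2
  nlinarith [(Nat.cast_nonneg C : (0 : ℝ) ≤ C), (Nat.cast_nonneg N : (0 : ℝ) ≤ N),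
    mul_nonneg (Nat.cast_nonneg C : (0 : ℝ) ≤ C) (Nat.cast_nonneg N : (0 : ℝ) ≤ N)]

theorem IsMinimallyNonlinear.not_hasLinearEx {α : Type*} [LinearOrder α] {G : SimpleGraph α}
    (hG : IsMinimallyNonlinear G) : ¬ HasLinearEx G :=
  fun h => h.not_isLittleO hG.1

/-- Proper induced subgraphs of a minimally non-linear ordered graph are linear. -/
theorem IsMinimallyNonlinear.hasLinearEx_comap {α β : Type*} [LinearOrder α] [Fintype α]
    [LinearOrder β] [Fintype β] {G : SimpleGraph α} (hG : IsMinimallyNonlinear G)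
    (f : β ↪o α) (h : Fintype.card β < Fintype.card α) : HasLinearEx (G.comap f) := by
  let e : Fin (Fintype.card β) ≃o β := Fintype.orderIsoFinOfCardEq β rfl
  refine HasLinearEx.of_contains (OrderedContains.comap_orderIso (G.comap f) e)
    (HasLinearEx.of_isBigO (hG.2 _ ((G.comap f).comap e) ?_ ?_))
  · exact OrderedContains.comap G (e.toOrderEmbedding.trans f)
  · rintro ⟨g, -⟩
    have := Fintype.card_le_of_injective g g.injective
    rw [Fintype.card_fin] at this
    omega

/-- A finite set of vertices inducing a non-linear ordered graph is everything. -/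
theorem IsMinimallyNonlinear.card_le_of_not_hasLinearEx {α : Type*} [LinearOrder α] [Fintype α]
    {G : SimpleGraph α} (hG : IsMinimallyNonlinear G) (W : Finset α)
    (h : ¬ HasLinearEx (G.comap (OrderEmbedding.subtype (· ∈ W)))) :
    Fintype.card α ≤ W.card := by
  by_contra hlt
  refine h (hG.hasLinearEx_comap _ ?_)
  rw [Fintype.card_coe]
  omega

/-! ### Inserting a vertex of degree one -/

/-- Two neighbours of `a` on the same side of `a`, whose numbers of neighbours of `a` between them
and `a` have the same parity, are separated by a neighbour of `a`. -/
theorem exists_adj_between {X : Type*} [LinearOrder X] [Fintype X] (H : SimpleGraph X)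
    {a b c : X} (hab : H.Adj a b) (hac : H.Adj a c) (hbc : b < c) (hside : a < b ∨ c < a)
    (hpar : {t | min a b < t ∧ t < max a b ∧ H.Adj a t}.ncard % 2 =
      {t | min a c < t ∧ t < max a c ∧ H.Adj a t}.ncard % 2) :
    ∃ t, b < t ∧ t < c ∧ H.Adj a t := by
  by_contra! hno
  rcases hside with h | h
  · have h' : a < c := h.trans hbc
    rw [min_eq_left h.le, max_eq_right h.le, min_eq_left h'.le, max_eq_right h'.le] at hpar
    -- With no neighbour of `a` between `b` and `c`, the two counted sets differ by exactly one
    -- element, so the parities differ.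
    have : {t | a < t ∧ t < c ∧ H.Adj a t} = insert b {t | a < t ∧ t < b ∧ H.Adj a t} := by
      ext t
      simp only [Set.mem_ofPred_eq, Set.mem_insert_iff]
      constructor
      · rintro ⟨h1, h2, h3⟩
        rcases lt_trichotomy t b with h4 | h4 | h4
        · exact Or.inr ⟨h1, h4, h3⟩
        · exact Or.inl h4
        · exact absurd h3 (hno t h4 h2)
      · rintro (rfl | ⟨h1, h2, h3⟩)
        · exact ⟨h, hbc, hab⟩
        · exact ⟨h1, h2.trans hbc, h3⟩
    rw [this, Set.ncard_insert_of_notMem (fun h => lt_irrefl _ h.2.1)] at hpar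
    omega
  · have h' : b < a := hbc.trans h
    rw [min_eq_right h.le, max_eq_left h.le, min_eq_right h'.le, max_eq_left h'.le] at hpar
    have : {t | b < t ∧ t < a ∧ H.Adj a t} = insert c {t | c < t ∧ t < a ∧ H.Adj a t} := by
      ext t
      simp only [Set.mem_ofPred_eq, Set.mem_insert_iff]
      constructor
      · rintro ⟨h1, h2, h3⟩
        rcases lt_trichotomy t c with h4 | h4 | h4
        · exact absurd h3 (hno t h1 h4)
        · exact Or.inl h4
        · exact Or.inr ⟨h4, h2, h3⟩
      · rintro (rfl | ⟨h1, h2, h3⟩)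
        · exact ⟨hbc, h, hac⟩
        · exact ⟨hbc.trans h1, h2, h3⟩
    rw [this, Set.ncard_insert_of_notMem (fun h => lt_irrefl _ h.1)] at hpar
    omega

/-- Insertion of a vertex of degree one between two consecutive neighbours of its neighbour
preserves linearity. -/
theorem HasLinearEx.of_insert_between {α : Type*} [LinearOrder α] {G : SimpleGraph α}
    {x u w v : α} (hxu : G.Adj x u) (hxv : G.Adj x v) (hw : ∀ y, G.Adj w y → y = x)
    (huw : u < w) (hwv : w < v) (hconsec : ∀ t, u < t → t < v → t = w)
    (hG : HasLinearEx (G.comap (OrderEmbedding.subtype (· ≠ w)))) : HasLinearEx G := by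
  classical
  obtain ⟨C, hC⟩ := hG
  refine ⟨2 * C, fun n H hH => ?_⟩
  have hxw : x ≠ w := by
    rintro rfl
    exact (hw u hxu ▸ huw).ne rfl
  have hside : x < u ∨ v < x := by
    by_contra! h
    rcases h.1.eq_or_lt with h1 | h1
    · exact hxu.ne h1.symm
    rcases h.2.eq_or_lt with h2 | h2
    · exact hxv.ne h2
    exact hxw (hconsec x h1 h2)
  -- `π` selects the end of an edge that plays the role of `x`.
  let π : Fin n → Fin n → Fin n := if x < u then min else max
  have hπ : ∀ a b, π a b = π b a := fun a b => by
    by_cases h : x < u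
    · simp only [π, if_pos h, min_comm]
    · simp only [π, if_neg h, max_comm]
  -- Edges are classified by the parity of the number of neighbours of that end strictly inside the
  -- edge. In a copy of `G` minus `w` within one class, the images of `xu` and `xv` have equal
  -- parity, which yields a neighbour between them to serve as `w`.
  let P : ℕ → SimpleGraph (Fin n) := fun i =>
    { Adj := fun y z => H.Adj y z ∧
        {t | min y z < t ∧ t < max y z ∧ H.Adj (π y z) t}.ncard % 2 = i
      symm := ⟨fun y z h => ⟨h.1.symm, by rw [min_comm, max_comm, hπ]; exact h.2⟩⟩
      loopless := ⟨fun y h => H.loopless.irrefl y h.1⟩ }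
  have hP : ∀ i, OrderedAvoids (P i) (G.comap (OrderEmbedding.subtype (· ≠ w))) := by
    rintro i ⟨f, hf⟩
    have hxu' : u ≠ w := huw.ne
    have hxv' : v ≠ w := hwv.ne'
    let X : {t // t ≠ w} := ⟨x, hxw⟩
    let U : {t // t ≠ w} := ⟨u, hxu'⟩
    let V : {t // t ≠ w} := ⟨v, hxv'⟩
    have e1 := hf X U hxu
    have e2 := hf X V hxv
    have hUV : f U < f V := f.lt_iff_lt.2 (huw.trans hwv)
    have hside' : f X < f U ∨ f V < f X :=
      hside.imp (fun h => f.lt_iff_lt.2 h) (fun h => f.lt_iff_lt.2 h)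
    have p1 : π (f X) (f U) = f X := by
      by_cases h : x < u
      · simp only [π, if_pos h]
        exact min_eq_left (f.lt_iff_lt.2 h).le
      · simp only [π, if_neg h]
        exact max_eq_left (f.le_iff_le.2 (not_lt.1 h))
    have p2 : π (f X) (f V) = f X := by
      by_cases h : x < u
      · simp only [π, if_pos h]
        exact min_eq_left (f.lt_iff_lt.2 (h.trans (huw.trans hwv))).le
      · simp only [π, if_neg h]
        exact max_eq_left (f.lt_iff_lt.2 (hside.resolve_left h)).le
    obtain ⟨t, ht1, ht2, ht3⟩ := exists_adj_between H e1.1 e2.1 hUV hside' (by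
      have h1 := e1.2
      have h2 := e2.2
      rw [p1] at h1
      rw [p2] at h2
      rw [h1, h2])
    let g : α → Fin n := fun s => if h : s = w then t else f ⟨s, h⟩
    have gw : g w = t := dif_pos rfl
    have gne : ∀ s (h : s ≠ w), g s = f ⟨s, h⟩ := fun s h => dif_neg h
    have hg : StrictMono g := by
      intro a b hab
      by_cases ha : a = w
      · subst ha
        have hb : b ≠ a := hab.ne'
        rw [gw, gne b hb]
        refine ht2.trans_le (f.le_iff_le.2 ?_)
        change v ≤ b
        by_contra hlt
        exact hb (hconsec b (huw.trans hab) (not_le.1 hlt))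
      · by_cases hb : b = w
        · subst hb
          rw [gw, gne a ha]
          refine lt_of_le_of_lt (f.le_iff_le.2 ?_) ht1
          change a ≤ u
          by_contra hlt
          exact ha (hconsec a (not_le.1 hlt) (hab.trans hwv))
        · rw [gne a ha, gne b hb]
          exact f.lt_iff_lt.2 hab
    refine hH ⟨OrderEmbedding.ofStrictMono g hg, fun a b hab => ?_⟩
    change H.Adj (g a) (g b)
    by_cases ha : a = w
    · subst ha
      have := hw b hab
      subst this
      rw [gw, gne b hxw]
      exact ht3.symm
    · by_cases hb : b = w
      · subst hb
        have := hw a hab.symm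
        subst this
        rw [gw, gne a hxw]
        exact ht3
      · rw [gne a ha, gne b hb]
        exact (hf ⟨a, ha⟩ ⟨b, hb⟩ hab).1
  have hle : H.edgeSet ⊆ (P 0).edgeSet ∪ (P 1).edgeSet := by
    intro e
    induction e with | _ y z
    intro h
    rcases Nat.mod_two_eq_zero_or_one
      {t | min y z < t ∧ t < max y z ∧ H.Adj (π y z) t}.ncard with h0 | h0
    · exact Or.inl ⟨h, h0⟩
    · exact Or.inr ⟨h, h0⟩
  have h1 := Set.ncard_le_ncard hle (Set.toFinite _)
  have h2 := Set.ncard_union_le (P 0).edgeSet (P 1).edgeSet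
  have h3 := hC n _ (hP 0)
  have h4 := hC n _ (hP 1)
  linarith

/-! ### Inserting an isolated vertex -/

theorem ncard_edgeSet_eq_card_arcs {n : ℕ} (H : SimpleGraph (Fin n)) :
    H.edgeSet.ncard = {p : Fin n × Fin n | p.1 < p.2 ∧ H.Adj p.1 p.2}.ncard := by
  have himg : H.edgeSet =
      (fun p : Fin n × Fin n => s(p.1, p.2)) '' {p | p.1 < p.2 ∧ H.Adj p.1 p.2} := by
    ext e
    induction e with | _ y z
    constructor
    · intro h
      have hadj : H.Adj y z := h
      rcases lt_or_gt_of_ne hadj.ne with hlt | hlt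
      · exact ⟨(y, z), ⟨hlt, hadj⟩, rfl⟩
      · exact ⟨(z, y), ⟨hlt, hadj.symm⟩, Sym2.eq_swap⟩
    · rintro ⟨⟨a, b⟩, ⟨-, h⟩, he⟩
      rw [← he]
      exact h
  rw [himg, Set.InjOn.ncard_image]
  rintro ⟨a, b⟩ ⟨hab, -⟩ ⟨c, d⟩ ⟨hcd, -⟩ h
  rcases Sym2.eq_iff.1 h with ⟨h1, h2⟩ | ⟨h1, h2⟩
  · exact Prod.ext h1 h2
  · simp only at h1 h2 hab hcd
    subst h1 h2
    exact absurd hab hcd.not_gt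

open Classical in
theorem ncard_edgeSet_eq_card_filter {n : ℕ} (H : SimpleGraph (Fin n)) :
    H.edgeSet.ncard =
      (Finset.univ.filter fun p : Fin n × Fin n => p.1 < p.2 ∧ H.Adj p.1 p.2).card := by
  rw [ncard_edgeSet_eq_card_arcs, ← Set.ncard_coe_finset]
  congr 1
  ext p
  simp

/-- Insertion of an isolated vertex preserves linearity, provided that all edges cross a cut of
the vertex order. -/
theorem HasLinearEx.of_isolated {α : Type*} [LinearOrder α] [Fintype α] {G : SimpleGraph α}
    (Lft : α → Prop) (hcut : ∀ a b, a < b → G.Adj a b → Lft a ∧ ¬ Lft b)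
    (hlow : ∀ a b, a ≤ b → Lft b → Lft a) {w : α} (hw : ∀ y, ¬ G.Adj w y)
    (hG : HasLinearEx (G.comap (OrderEmbedding.subtype (· ≠ w)))) : HasLinearEx G := by
  classical
  obtain ⟨C, hC⟩ := hG
  refine ⟨4 * C + 25, fun n H hH => ?_⟩
  rcases Nat.lt_or_ge n 5 with hn | hn
  · refine (ncard_edgeSet_le_sq H).trans ?_
    have : n * n ≤ 25 * 1 := Nat.mul_le_mul (by omega : n ≤ 5) (by omega : n ≤ 5) |>.trans (by omega)
    exact this.trans (Nat.mul_le_mul (by omega) (by omega))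
  obtain ⟨m, hm⟩ : ∃ m, m = (n - 3) / 2 := ⟨_, rfl⟩
  -- Consecutive vertices are merged in pairs, with left ends remembering parity `p` and right ends
  -- parity `q`. A copy found in one class then lifts to `H` with free room between any two vertices
  -- and at both ends.
  let P : ℕ → ℕ → SimpleGraph (Fin m) := fun p q =>
    { Adj := fun i j => i ≠ j ∧ ∃ y z : Fin n, H.Adj y z ∧ (y : ℕ) = 2 * (min i j : Fin m) + p + 1 ∧
        (z : ℕ) = 2 * (max i j : Fin m) + q + 2
      symm := ⟨fun i j h => ⟨h.1.symm, by rw [min_comm, max_comm]; exact h.2⟩⟩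
      loopless := ⟨fun i h => h.1 rfl⟩ }
  have hP : ∀ p < 2, ∀ q < 2,
      OrderedAvoids (P p q) (G.comap (OrderEmbedding.subtype (· ≠ w))) := by
    rintro p hp q hq ⟨f, hf⟩
    let pos : {t // t ≠ w} → ℕ := fun t =>
      if Lft t then 2 * (f t : ℕ) + p + 1 else 2 * (f t : ℕ) + q + 2
    have posL : ∀ t : {t // t ≠ w}, Lft t → pos t = 2 * (f t : ℕ) + p + 1 := fun t h => if_pos h
    have posR : ∀ t : {t // t ≠ w}, ¬ Lft t → pos t = 2 * (f t : ℕ) + q + 2 :=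
      fun t h => if_neg h
    have pos_bd : ∀ t, 1 ≤ pos t ∧ pos t + 2 ≤ n := fun t => by
      have := (f t).2
      by_cases h : Lft t
      · rw [posL t h]; omega
      · rw [posR t h]; omega
    -- The offsets `1` for left and `2` for right vertices keep this gap even from `p = 1` to `q =
    -- 0`.
    have pos_gap : ∀ s t, s < t → pos s + 2 ≤ pos t := fun s t hst => by
      have h1 : (f s : ℕ) < f t := f.lt_iff_lt.2 hst
      by_cases hs : Lft s
      · by_cases ht : Lft t
        · rw [posL s hs, posL t ht]; omega
        · rw [posL s hs, posR t ht]; omega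
      · have ht : ¬ Lft t := fun ht => hs (hlow s t (le_of_lt hst) ht)
        rw [posR s hs, posR t ht]; omega
    -- The place right after the last vertex below `w`. If there is none, the empty supremum `0` is
    -- free, since all positions are at least `1`.
    let gw : ℕ := (Finset.univ.filter fun t : {t // t ≠ w} => (t : α) < w).sup fun t => pos t + 1
    have gw_gt : ∀ t : {t // t ≠ w}, (t : α) < w → pos t < gw := fun t ht =>
      Nat.lt_of_succ_le (Finset.le_sup (f := fun t => pos t + 1)
        (Finset.mem_filter.2 ⟨Finset.mem_univ t, ht⟩))
    have gw_lt : ∀ t : {t // t ≠ w}, w < t → gw < pos t := fun t ht => by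
      refine (Finset.sup_lt_iff (by have := (pos_bd t).1; exact this)).2 fun s hs => ?_
      have := pos_gap s t (show (s : α) < t from (Finset.mem_filter.1 hs).2.trans ht)
      omega
    have gw_n : gw < n := by
      refine (Finset.sup_lt_iff (by change 0 < n; omega)).2 fun s _ => ?_
      have := (pos_bd s).2
      omega
    let g : α → Fin n := fun t =>
      if h : t = w then ⟨gw, gw_n⟩ else ⟨pos ⟨t, h⟩, by have := (pos_bd ⟨t, h⟩).2; omega⟩
    have g_w : (g w : ℕ) = gw := by simp [g]
    have g_ne : ∀ t (h : t ≠ w), (g t : ℕ) = pos ⟨t, h⟩ := fun t h => by simp [g, h]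
    have hg : StrictMono g := by
      intro a b hab
      rw [Fin.lt_def]
      by_cases ha : a = w
      · subst ha
        rw [g_w, g_ne b hab.ne']
        exact gw_lt _ hab
      · by_cases hb : b = w
        · subst hb
          rw [g_w, g_ne a ha]
          exact gw_gt _ hab
        · rw [g_ne a ha, g_ne b hb]
          have := pos_gap ⟨a, ha⟩ ⟨b, hb⟩ hab
          omega
    have key : ∀ a b, a < b → G.Adj a b → H.Adj (g a) (g b) := by
      intro a b hlt hab
      have ha : a ≠ w := fun h => hw b (h ▸ hab)
      have hb : b ≠ w := fun h => hw a (h ▸ hab.symm)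
      obtain ⟨hLa, hLb⟩ := hcut a b hlt hab
      obtain ⟨-, y, z, hyz, hy, hz⟩ := hf ⟨a, ha⟩ ⟨b, hb⟩ hab
      have hfl : f ⟨a, ha⟩ < f ⟨b, hb⟩ := f.lt_iff_lt.2 hlt
      rw [min_eq_left hfl.le] at hy
      rw [max_eq_right hfl.le] at hz
      have h1 : g a = y := Fin.ext (by rw [g_ne a ha, posL _ hLa, hy])
      have h2 : g b = z := Fin.ext (by rw [g_ne b hb, posR _ hLb, hz])
      rw [h1, h2]
      exact hyz
    refine hH ⟨OrderEmbedding.ofStrictMono g hg, fun a b hab => ?_⟩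
    rcases lt_or_gt_of_ne hab.ne with hlt | hlt
    · exact key a b hlt hab
    · exact (key b a hlt hab.symm).symm
  obtain ⟨arcs, hmem, harcs⟩ : ∃ arcs : ∀ k : ℕ, SimpleGraph (Fin k) → Finset (Fin k × Fin k),
      (∀ k K p, p ∈ arcs k K ↔ p.1 < p.2 ∧ K.Adj p.1 p.2) ∧
      ∀ k K, K.edgeSet.ncard = (arcs k K).card :=
    ⟨fun k K => Finset.univ.filter fun p => p.1 < p.2 ∧ K.Adj p.1 p.2, fun k K p => by simp,
      fun k K => (ncard_edgeSet_eq_card_filter K).trans (by congr)⟩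
  let φ : Fin n × Fin n → ℕ × ℕ := fun p => (p.1, p.2)
  have hφ : Function.Injective φ := fun p q h => by
    have h1 := congrArg Prod.fst h
    have h2 := congrArg Prod.snd h
    exact Prod.ext (Fin.ext h1) (Fin.ext h2)
  let ψ : ℕ × ℕ → Fin m × Fin m → ℕ × ℕ := fun c p =>
    (2 * (p.1 : ℕ) + c.1 + 1, 2 * (p.2 : ℕ) + c.2 + 2)
  -- `J₁`, `J₂`, `J₃` hold the linearly many edges possibly lost in merging: those starting at `0`,
  -- ending among the last four vertices, or of length below four.
  let J₁ : Finset (ℕ × ℕ) := {0} ×ˢ Finset.range n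
  let J₂ : Finset (ℕ × ℕ) := Finset.range n ×ˢ Finset.Ico (n - 4) n
  let J₃ : Finset (ℕ × ℕ) := (Finset.range n ×ˢ Finset.range 4).image fun p => (p.1, p.1 + p.2)
  let B : Finset (ℕ × ℕ) := (Finset.range 2 ×ˢ Finset.range 2).biUnion fun c =>
    (arcs m (P c.1 c.2)).image (ψ c)
  have hsub : (arcs n H).image φ ⊆ J₁ ∪ (J₂ ∪ (J₃ ∪ B)) := by
    intro e he
    obtain ⟨⟨y, z⟩, hyz, rfl⟩ := Finset.mem_image.1 he
    obtain ⟨hlt, hadj⟩ : y < z ∧ H.Adj y z := (hmem _ _ _).1 hyz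
    have hlt' : (y : ℕ) < z := hlt
    have hz := z.2
    simp only [Finset.mem_union]
    by_cases h1 : (y : ℕ) = 0
    · exact Or.inl (Finset.mem_product.2 ⟨by simp [φ, h1], by simp [φ]⟩)
    by_cases h2 : n - 4 ≤ (z : ℕ)
    · exact Or.inr (Or.inl (Finset.mem_product.2 ⟨by simp [φ], by simp [φ]; omega⟩))
    by_cases h3 : (z : ℕ) < y + 4
    · refine Or.inr (Or.inr (Or.inl (Finset.mem_image.2 ⟨(y, z - y), ?_, ?_⟩)))
      · simp; omega
      · exact Prod.ext rfl (by change (y : ℕ) + (z - y) = z; omega)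
    obtain ⟨i, hi⟩ : ∃ i : Fin m, (i : ℕ) = ((y : ℕ) - 1) / 2 := ⟨⟨_, by omega⟩, rfl⟩
    obtain ⟨j, hj⟩ : ∃ j : Fin m, (j : ℕ) = ((z : ℕ) - 2) / 2 := ⟨⟨_, by omega⟩, rfl⟩
    have hij : i < j := by
      rw [Fin.lt_def]
      omega
    refine Or.inr (Or.inr (Or.inr (Finset.mem_biUnion.2
      ⟨(((y : ℕ) - 1) % 2, ((z : ℕ) - 2) % 2), ?_, Finset.mem_image.2 ⟨(i, j), ?_, ?_⟩⟩)))
    · exact Finset.mem_product.2 ⟨Finset.mem_range.2 (Nat.mod_lt _ two_pos),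
        Finset.mem_range.2 (Nat.mod_lt _ two_pos)⟩
    · refine (hmem _ _ _).2 ⟨hij, hij.ne, y, z, hadj, ?_, ?_⟩
      · simp only [min_eq_left hij.le]
        omega
      · simp only [max_eq_right hij.le]
        omega
    · refine Prod.ext ?_ ?_
      · change 2 * (i : ℕ) + ((y : ℕ) - 1) % 2 + 1 = y
        omega
      · change 2 * (j : ℕ) + ((z : ℕ) - 2) % 2 + 2 = z
        omega
  have hB : B.card ≤ 4 * (C * (m + 1)) := by
    refine (Finset.card_biUnion_le_card_mul _ _ (C * (m + 1)) fun c hc => ?_).trans (by simp)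
    refine Finset.card_image_le.trans ?_
    rw [← harcs]
    obtain ⟨h1, h2⟩ := Finset.mem_product.1 hc
    exact hC m _ (hP _ (Finset.mem_range.1 h1) _ (Finset.mem_range.1 h2))
  have hJ₁ : J₁.card = n := by simp [J₁]
  have hJ₂ : J₂.card = n * 4 := by
    simp only [J₂, Finset.card_product, Finset.card_range, Nat.card_Ico]
    congr 1
    omega
  have hJ₃ : J₃.card ≤ n * 4 := Finset.card_image_le.trans (by simp)
  have h1 := Finset.card_le_card hsub
  rw [Finset.card_image_of_injective _ hφ, ← harcs] at h1
  have h2 := Finset.card_union_le J₁ (J₂ ∪ (J₃ ∪ B))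
  have h3 := Finset.card_union_le J₂ (J₃ ∪ B)
  have h4 := Finset.card_union_le J₃ B
  have h5 : C * (m + 1) ≤ C * (n + 1) := Nat.mul_le_mul_left _ (by omega)
  nlinarith

/-! ### Counting columns -/

/-- If no two letters alternate `a b a b` along the columns `0, …, c - 1`, no two letters share two
columns, and a letter common to three consecutive columns is never alone in the middle one, then
there are at most `4 k - 2` columns, where `k` is the number of letters. -/
theorem card_columns_le {A : Type*} [Fintype A] (c : ℕ) (S : ℕ → A → Prop)
    (hne : ∀ i < c, ∃ a, S i a)
    (hC4 : ∀ i j a b, i < j → j < c → a ≠ b → S i a → S i b → S j a → S j b → False)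
    (halt : ∀ i j k l a b, i < j → j < k → k < l → l < c → a ≠ b →
      S i a → S j b → S k a → S l b → False)
    (hmid : ∀ i a, i + 2 < c → S i a → S (i + 1) a → S (i + 2) a → ∃ b, b ≠ a ∧ S (i + 1) b)
    (hc : 0 < c) : c + 2 ≤ 4 * Fintype.card A := by
  classical
  -- Breaks: `t` stands for the gap before column `t`, across which no letter continues; the outer
  -- gaps `0` and `c` count as breaks. `I` collects the columns with no break on either side.
  let T : Finset ℕ := (Finset.range (c + 1)).filter
    fun t => t = 0 ∨ t = c ∨ ∀ a, ¬ (S (t - 1) a ∧ S t a)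
  let I : Finset ℕ := (Finset.range c).filter fun i => i ∉ T ∧ i + 1 ∉ T
  have hT : ∀ t, t ∈ T ↔ t ≤ c ∧ (t = 0 ∨ t = c ∨ ∀ a, ¬ (S (t - 1) a ∧ S t a)) := fun t => by
    simp [T]
  have hI : ∀ i, i ∈ I ↔ i < c ∧ i ∉ T ∧ i + 1 ∉ T := fun i => by simp [I]
  have h0 : 0 ∈ T := by simp [hT]
  have hcT : c ∈ T := by simp [hT]
  -- A column outside `I` has a break on its left (not `c`) or on its right (not `0`).
  have hcols : c ≤ I.card + ((T.card - 1) + (T.card - 1)) := by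
    have hsub : Finset.range c ⊆ I ∪ (T.erase c ∪ (T.erase 0).image (· - 1)) := by
      intro i hi
      rw [Finset.mem_range] at hi
      simp only [Finset.mem_union, Finset.mem_erase, Finset.mem_image]
      by_cases h1 : i ∈ T
      · exact Or.inr (Or.inl ⟨by omega, h1⟩)
      · by_cases h2 : i + 1 ∈ T
        · exact Or.inr (Or.inr ⟨i + 1, ⟨by omega, h2⟩, by omega⟩)
        · exact Or.inl ((hI i).2 ⟨hi, h1, h2⟩)
    have h1 := Finset.card_le_card hsub
    have h2 := Finset.card_union_le I (T.erase c ∪ (T.erase 0).image (· - 1))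
    have h3 := Finset.card_union_le (T.erase c) ((T.erase 0).image (· - 1))
    have h4 := Finset.card_image_le (s := T.erase 0) (f := (· - 1))
    rw [Finset.card_range] at h1
    rw [Finset.card_erase_of_mem h0] at h4
    rw [Finset.card_erase_of_mem hcT] at h3
    omega
  let occ : A → Finset ℕ := fun a => (Finset.range c).filter fun i => S i a
  have hocc : ∀ a i, i ∈ occ a ↔ i < c ∧ S i a := fun a i => by simp [occ]
  -- First and last occurrences. Letters occurring nowhere receive `0`, which is harmless: only
  -- surjectivity of `Φ` is used.
  let F : A → ℕ := fun a => sInf (occ a : Set ℕ)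
  let L : A → ℕ := fun a => (occ a).sup id
  have hF : ∀ a i, i < c → S i a → (∀ j < i, ¬ S j a) → F a = i := by
    intro a i hi hS hj
    have hmem : i ∈ (occ a : Set ℕ) := (hocc a i).2 ⟨hi, hS⟩
    refine le_antisymm (Nat.sInf_le hmem) ?_
    by_contra hlt
    exact hj _ (not_le.1 hlt) ((hocc a _).1 (Nat.sInf_mem ⟨i, hmem⟩)).2
  have hL : ∀ a i, i < c → S i a → (∀ j, i < j → j < c → ¬ S j a) → L a = i := by
    intro a i hi hS hj
    refine le_antisymm (Finset.sup_le fun j hjm => ?_)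
      (Finset.le_sup (f := id) ((hocc a i).2 ⟨hi, hS⟩))
    have := (hocc a j).1 hjm
    by_contra hlt
    exact hj j (not_le.1 hlt) this.1 this.2
  -- An occurrence in a column of `I` is charged to that column; otherwise a first one goes to the
  -- gap before it and a last one to the gap after it.
  let Φ : A × Bool → ℕ ⊕ ℕ := fun e =>
    if e.2 then (if F e.1 ∈ I then Sum.inr (F e.1) else Sum.inl (F e.1))
    else (if L e.1 ∈ I then Sum.inr (L e.1) else Sum.inl (L e.1 + 1))
  have hΦF : ∀ a, Φ (a, true) = if F a ∈ I then Sum.inr (F a) else Sum.inl (F a) := fun a => rfl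
  have hΦL : ∀ a, Φ (a, false) = if L a ∈ I then Sum.inr (L a) else Sum.inl (L a + 1) :=
    fun a => rfl
  have hsurj : T.disjSum I ⊆ Finset.univ.image Φ := by
    intro x hx
    rw [Finset.mem_image]
    have first : ∀ t a, t ∈ T → F a = t → ∃ e ∈ Finset.univ, Φ e = Sum.inl t := fun t a ht h =>
      ⟨(a, true), Finset.mem_univ _, by rw [hΦF, h, if_neg fun hi => ((hI t).1 hi).2.1 ht]⟩
    have last : ∀ t a, t + 1 ∈ T → L a = t → ∃ e ∈ Finset.univ, Φ e = Sum.inl (t + 1) :=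
      fun t a ht h =>
      ⟨(a, false), Finset.mem_univ _, by rw [hΦL, h, if_neg fun hi => ((hI t).1 hi).2.2 ht]⟩
    rcases Finset.mem_disjSum.1 hx with ⟨t, ht, rfl⟩ | ⟨i, hi, rfl⟩
    · obtain ⟨htc, h⟩ := (hT t).1 ht
      rcases Nat.eq_zero_or_pos t with rfl | htpos
      · obtain ⟨a, ha⟩ := hne 0 hc
        exact first 0 a ht (hF a 0 hc ha fun j hj => by omega)
      obtain ⟨s, rfl⟩ : ∃ s, t = s + 1 := ⟨t - 1, by omega⟩
      obtain ⟨a, ha⟩ := hne s (by omega)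
      by_cases hla : ∀ j, s < j → j < c → ¬ S j a
      · exact last s a ht (hL a s (by omega) ha hla)
      push Not at hla
      obtain ⟨l, hsl, hlc, hl⟩ := hla
      have hdis : ∀ a, ¬ (S s a ∧ S (s + 1) a) := by
        rcases h with h | h | h
        · omega
        · omega
        · simpa using h
      -- As `a` reappears beyond the break, an earlier occurrence of `b` would give `b a b a`.
      obtain ⟨b, hb⟩ := hne (s + 1) (by omega)
      have hab : a ≠ b := fun h => hdis a ⟨ha, h ▸ hb⟩
      refine first (s + 1) b ht (hF b _ (by omega) hb fun j hj hjb => ?_)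
      have hjs : j ≠ s := fun h => hdis b ⟨h ▸ hjb, hb⟩
      have hls : l ≠ s + 1 := fun h => hdis a ⟨ha, h ▸ hl⟩
      exact halt j s (s + 1) l b a (by omega) (by omega) (by omega) hlc hab.symm hjb ha hb hl
    · obtain ⟨hic, h1, h2⟩ := (hI i).1 hi
      have first : ∀ a, F a = i → ∃ e ∈ Finset.univ, Φ e = Sum.inr i := fun a h =>
        ⟨(a, true), Finset.mem_univ _, by rw [hΦF, h, if_pos hi]⟩
      have last : ∀ a, L a = i → ∃ e ∈ Finset.univ, Φ e = Sum.inr i := fun a h =>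
        ⟨(a, false), Finset.mem_univ _, by rw [hΦL, h, if_pos hi]⟩
      simp only [hT, not_and, not_or, not_forall, not_not] at h1 h2
      obtain ⟨hi0, -, p, hp, hpi⟩ := h1 (by omega)
      obtain ⟨-, hic', q, hq, hqi⟩ := h2 (by omega)
      obtain ⟨s, rfl⟩ : ∃ s, i = s + 1 := ⟨i - 1, by omega⟩
      simp only [Nat.add_sub_cancel] at hp hq
      -- `p` comes from the left neighbour and `q` continues to the right one. If they agree, the
      -- extra letter `y` starts here; if not, either `p` ends here or `q` starts here. Anything
      -- else creates a 4-cycle or an alternation.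
      by_cases hpq : p = q
      · subst hpq
        obtain ⟨y, hyp, hy⟩ := hmid s p (by omega) hp hpi hqi
        refine first y (hF y _ hic hy fun j hj hjy => ?_)
        rcases eq_or_ne j s with rfl | hjs
        · exact hC4 j (j + 1) y p (by omega) hic hyp hjy hp hy hpi
        · exact halt j s (s + 1) (s + 1 + 1) y p (by omega) (by omega) (by omega) (by omega) hyp
            hjy hp hy hqi
      · by_cases hlp : ∀ j, s + 1 < j → j < c → ¬ S j p
        · exact last p (hL p _ hic hpi hlp)
        push Not at hlp
        obtain ⟨l, hsl, hlc, hl⟩ := hlp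
        refine first q (hF q _ hic hq fun j hj hjq => ?_)
        rcases eq_or_ne j s with rfl | hjs
        · exact hC4 j (j + 1) p q (by omega) hic hpq hp hjq hpi hq
        · exact halt j s (s + 1) l q p (by omega) (by omega) (by omega) hlc (Ne.symm hpq)
            hjq hp hq hl
  have h1 := (Finset.card_le_card hsurj).trans Finset.card_image_le
  rw [Finset.card_disjSum, Finset.card_univ, Fintype.card_prod, Fintype.card_bool] at h1
  have h2 : 0 < T.card := Finset.card_pos.2 ⟨0, h0⟩
  omega

/-! ### Orders on a set with added copies of another -/

/-- The disjoint union of `A` and of one copy of `C` for each element of `B`. -/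
inductive Stacked (A B C : Type) : Type
  | old (a : A) : Stacked A B C
  | new (b : B) (c : C) : Stacked A B C

namespace Stacked

variable {A B C : Type}

/-- The disjoint union as a sum type. -/
def equivSum (A B C : Type) : Stacked A B C ≃ A ⊕ (B × C) where
  toFun | old a => .inl a | new b c => .inr (b, c)
  invFun | .inl a => old a | .inr p => new p.1 p.2
  left_inv x := by cases x <;> rfl
  right_inv x := by rcases x with a | ⟨b, c⟩ <;> rfl

instance [Fintype A] [Fintype B] [Fintype C] : Fintype (Stacked A B C) :=
  Fintype.ofEquiv _ (equivSum A B C).symm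

theorem card_eq [Fintype A] [Fintype B] [Fintype C] :
    Fintype.card (Stacked A B C) =
      Fintype.card A + Fintype.card B * Fintype.card C := by
  rw [Fintype.card_congr (equivSum A B C), Fintype.card_sum, Fintype.card_prod]

/-- The position of an element when each copy of `C` stands immediately before an element
of `A`. -/
def insertKey (spot : B → A) : Stacked A B C → A ×ₗ WithTop C
  | old a => toLex (a, ⊤)
  | new b c => toLex (spot b, (c : WithTop C))

theorem insertKey_injective {spot : B → A} (h : Function.Injective spot) :
    Function.Injective (insertKey (C := C) spot) := by
  intro x y hxy
  rcases x with a | ⟨b, c⟩ <;> rcases y with a' | ⟨b', c'⟩ <;>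
    simp only [insertKey, toLex_inj, Prod.mk.injEq] at hxy
  · rw [hxy.1]
  · exact absurd hxy.2.symm (WithTop.coe_ne_top)
  · exact absurd hxy.2 (WithTop.coe_ne_top)
  · rw [h hxy.1, WithTop.coe_inj.1 hxy.2]

/-- The position of an element when all copies of `C` stand after `A`. -/
def appendKey : Stacked A B C → A ⊕ₗ (B ×ₗ C)
  | old a => toLex (.inl a)
  | new b c => toLex (.inr (toLex (b, c)))

theorem appendKey_injective : Function.Injective (appendKey (A := A) (B := B) (C := C)) := by
  intro x y hxy
  rcases x with a | ⟨b, c⟩ <;> rcases y with a' | ⟨b', c'⟩ <;>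
    simp_all [appendKey]

section insertOrder

variable [LinearOrder A] [LinearOrder C] {spot : B → A} (h : Function.Injective spot)

/-- The order in which each copy of `C` stands immediately before an element of `A`. -/
abbrev insertOrder : LinearOrder (Stacked A B C) :=
  LinearOrder.lift' (insertKey spot) (insertKey_injective h)

theorem insert_old_lt_old {a a' : A} :
    (insertOrder (C := C) h).lt (old a) (old a') ↔ a < a' := by
  change toLex (a, (⊤ : WithTop C)) < toLex (a', ⊤) ↔ _
  simp [Prod.Lex.toLex_lt_toLex]

theorem insert_new_lt_old {a : A} {b : B} {c : C} :
    (insertOrder (C := C) h).lt (new b c) (old a) ↔ spot b ≤ a := by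
  change toLex (spot b, (c : WithTop C)) < toLex (a, ⊤) ↔ _
  simp [Prod.Lex.toLex_lt_toLex, le_iff_lt_or_eq]

theorem insert_old_lt_new {a : A} {b : B} {c : C} :
    (insertOrder (C := C) h).lt (old a) (new b c) ↔ a < spot b := by
  change toLex (a, (⊤ : WithTop C)) < toLex (spot b, (c : WithTop C)) ↔ _
  simp [Prod.Lex.toLex_lt_toLex]

theorem insert_new_lt_new {b b' : B} {c c' : C} :
    (insertOrder (C := C) h).lt (new b c) (new b' c') ↔ spot b < spot b' ∨ b = b' ∧ c < c' := by
  change toLex (spot b, (c : WithTop C)) < toLex (spot b', (c' : WithTop C)) ↔ _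
  simp [Prod.Lex.toLex_lt_toLex, h.eq_iff]

end insertOrder

section appendOrder

variable [LinearOrder A] [LinearOrder B] [LinearOrder C]

/-- The order in which all copies of `C` stand after `A`. -/
abbrev appendOrder : LinearOrder (Stacked A B C) :=
  LinearOrder.lift' appendKey appendKey_injective

theorem append_old_lt_old {a a' : A} :
    (appendOrder (B := B) (C := C)).lt (old a) (old a') ↔ a < a' := by
  change toLex (Sum.inl a : A ⊕ (B ×ₗ C)) < toLex (.inl a') ↔ _
  simp

theorem append_not_new_lt_old {a : A} {b : B} {c : C} :
    ¬ (appendOrder (A := A)).lt (new b c) (old a) := by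
  change ¬ toLex (Sum.inr (toLex (b, c)) : A ⊕ (B ×ₗ C)) < toLex (.inl a)
  simp

theorem append_new_lt_new {b b' : B} {c c' : C} :
    (appendOrder (A := A)).lt (new b c) (new b' c') ↔ b < b' ∨ b = b' ∧ c < c' := by
  change toLex (Sum.inr (toLex (b, c)) : A ⊕ (B ×ₗ C)) < toLex (.inr (toLex (b', c'))) ↔ _
  simp [Prod.Lex.toLex_lt_toLex]

end appendOrder

end Stacked

/-! ### Dense matrices without alternation -/

/-- A 0-1 matrix whose rows are grouped by the columns (`spot`s) of their first entries, `m` rows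
to a spot. Rows with a common first entry proceed in blocks, the larger row first. No two rows
`r < s` alternate `r s r s`. Every row has more than `d` entries. -/
structure FanMatrix (d m : ℕ) where
  Row : Type
  Col : Type
  Spot : Type
  [rowOrder : LinearOrder Row]
  [colOrder : LinearOrder Col]
  [spotOrder : LinearOrder Spot]
  [rowFintype : Fintype Row]
  [colFintype : Fintype Col]
  [spotFintype : Fintype Spot]
  Inc : Row → Col → Prop
  spot : Spot → Col
  spot_strictMono : StrictMono spot
  home : Row → Spot
  idx : Row → Fin m
  bij : Function.Bijective fun r => (home r, idx r)
  idx_lt : ∀ {r s}, home r = home s → r < s → idx r < idx s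
  inc_home : ∀ r, Inc r (spot (home r))
  first : ∀ {r c}, Inc r c → spot (home r) ≤ c
  home_eq : ∀ {r i}, Inc r (spot i) → home r = i
  block : ∀ {r s c c'}, home r = home s → r < s → Inc r c → Inc s c' → spot (home r) < c →
    ¬ c < c'
  avoids : ∀ {r s c₁ c₂ c₃ c₄}, r < s → c₁ < c₂ → c₂ < c₃ → c₃ < c₄ →
    Inc r c₁ → Inc s c₂ → Inc r c₃ → Inc s c₄ → False
  deg : ∀ r, d + 1 ≤ {c | Inc r c}.ncard

namespace FanMatrix

attribute [instance] rowOrder colOrder spotOrder rowFintype colFintype spotFintype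

theorem card_row {d m : ℕ} (F : FanMatrix d m) :
    Fintype.card F.Row = Fintype.card F.Spot * m := by
  rw [Fintype.card_of_bijective F.bij, Fintype.card_prod, Fintype.card_fin]

/-- One spot with `m` rows of a single entry. -/
def single (m : ℕ) : FanMatrix 0 m where
  Row := Fin m
  Col := Unit
  Spot := Unit
  Inc _ _ := True
  spot := id
  spot_strictMono := strictMono_id
  home _ := ()
  idx := id
  bij := ⟨fun _ _ h => (Prod.ext_iff.1 h).2, fun p => ⟨p.2, rfl⟩⟩
  idx_lt _ h := h
  inc_home _ := trivial
  first _ := le_rfl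
  home_eq _ := rfl
  block _ _ _ _ h := absurd h (lt_irrefl _)
  avoids _ h := absurd h (lt_irrefl _)
  deg _ := by simp [Set.ncard_univ]

/-- A matrix with `D` spots and no row. -/
def empty (d D : ℕ) : FanMatrix d 0 where
  Row := Empty
  Col := Fin D
  Spot := Fin D
  Inc r _ := r.elim
  spot := id
  spot_strictMono := strictMono_id
  home r := r.elim
  idx r := r.elim
  bij := ⟨fun r => r.elim, fun p => p.2.elim0⟩
  idx_lt {r} := r.elim
  inc_home r := r.elim
  first {r} := r.elim
  home_eq {r} := r.elim
  block {r} := r.elim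
  avoids {r} := r.elim
  deg r := r.elim

/-- The spots of `F` in reverse order, as `Fin f`. -/
noncomputable def revSpot {d m : ℕ} (F : FanMatrix d m) (i : Fin (Fintype.card F.Spot)) : F.Spot :=
  Fintype.orderIsoFinOfCardEq F.Spot rfl i.rev

theorem revSpot_lt {d m : ℕ} (F : FanMatrix d m) {i j : Fin (Fintype.card F.Spot)} (h : i < j) :
    F.revSpot j < F.revSpot i :=
  (Fintype.orderIsoFinOfCardEq F.Spot rfl).lt_iff_lt.2 (Fin.rev_lt_rev.2 h)

theorem revSpot_bijective {d m : ℕ} (F : FanMatrix d m) : Function.Bijective F.revSpot :=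
  (Fintype.orderIsoFinOfCardEq F.Spot rfl).bijective.comp Fin.rev_bijective

end FanMatrix

namespace FanMatrix

open Stacked

/-- Insert a copy of `F` before every spot of `K`, and let each row of `K` start in a spot of the
copy before its first entry. -/
noncomputable def stack {d m : ℕ} (F : FanMatrix (d + 1) m)
    (K : FanMatrix d (Fintype.card F.Spot)) : FanMatrix (d + 1) (m + 1) := by
  classical
  exact
  let hinj := K.spot_strictMono.injective
  letI rowO : LinearOrder (Stacked K.Row K.Spot F.Row) := appendOrder
  letI colO : LinearOrder (Stacked K.Col K.Spot F.Col) := insertOrder hinj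
  -- A row of `K` gains one entry, in the copy before its spot. Rows with a common spot take the
  -- spots of the copy in reverse order, so the larger row again comes first and `block` persists.
  let Inc : Stacked K.Row K.Spot F.Row → Stacked K.Col K.Spot F.Col → Prop := fun r c =>
    match r, c with
    | old x, old c => K.Inc x c
    | old x, new i c => K.home x = i ∧ c = F.spot (F.revSpot (K.idx x))
    | new _ _, old _ => False
    | new i z, new i' c => i = i' ∧ F.Inc z c
  let spot : K.Spot ×ₗ F.Spot → Stacked K.Col K.Spot F.Col := fun p =>
    new (ofLex p).1 (F.spot (ofLex p).2)
  let home : Stacked K.Row K.Spot F.Row → K.Spot ×ₗ F.Spot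
    | old x => toLex (K.home x, F.revSpot (K.idx x))
    | new i z => toLex (i, F.home z)
  let idx : Stacked K.Row K.Spot F.Row → Fin (m + 1)
    | old _ => 0
    | new _ z => (F.idx z).succ
  have hfirst : ∀ {r c}, Inc r c → spot (home r) ≤ c := by
    rintro (x | ⟨i, z⟩) (c | ⟨i', c⟩) h
    · exact le_of_lt ((insert_new_lt_old hinj).2 (K.first h))
    · obtain ⟨rfl, rfl⟩ := h
      exact le_rfl
    · exact h.elim
    · obtain ⟨rfl, h⟩ := h
      rcases (F.first h).eq_or_lt with h | h
      · exact le_of_eq (congrArg _ h)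
      · exact le_of_lt ((insert_new_lt_new hinj).2 (Or.inr ⟨rfl, h⟩))
  have hrow_new : ∀ {i i' : K.Spot} {z z' : F.Row},
      (new i z : Stacked K.Row K.Spot F.Row) < new i' z' ↔ i < i' ∨ i = i' ∧ z < z' :=
    append_new_lt_new
  have hcol_new : ∀ {i i' : K.Spot} {z z' : F.Col},
      (new i z : Stacked K.Col K.Spot F.Col) < new i' z' ↔ i < i' ∨ i = i' ∧ z < z' :=
    (insert_new_lt_new hinj).trans (or_congr_left K.spot_strictMono.lt_iff_lt)
  have hcol_no : ∀ {i : K.Spot} {z : F.Col} {c : K.Col},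
      (new i z : Stacked K.Col K.Spot F.Col) < old c ↔ K.spot i ≤ c := insert_new_lt_old hinj
  have hcol_on : ∀ {i : K.Spot} {z : F.Col} {c : K.Col},
      (old c : Stacked K.Col K.Spot F.Col) < new i z ↔ c < K.spot i := insert_old_lt_new hinj
  have hcol_old : ∀ {c c' : K.Col},
      (old c : Stacked K.Col K.Spot F.Col) < old c' ↔ c < c' := insert_old_lt_old hinj
  have hrow_old : ∀ {c c' : K.Row},
      (old c : Stacked K.Row K.Spot F.Row) < old c' ↔ c < c' := append_old_lt_old
  { Row := Stacked K.Row K.Spot F.Row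
    Col := Stacked K.Col K.Spot F.Col
    Spot := K.Spot ×ₗ F.Spot
    spotFintype := inferInstanceAs (Fintype (K.Spot × F.Spot))
    Inc := Inc
    spot := spot
    spot_strictMono := by
      intro p q hpq
      rw [Prod.Lex.lt_iff] at hpq
      exact hcol_new.2 (hpq.imp id (And.imp id fun h => F.spot_strictMono h))
    home := home
    idx := idx
    bij := by
      constructor
      · rintro (x | ⟨i, z⟩) (x' | ⟨i', z'⟩) h
        · obtain ⟨h1, h2⟩ := Prod.ext_iff.1 (toLex_inj.1 (Prod.ext_iff.1 h).1)
          exact congrArg old (K.bij.1 (Prod.ext h1 (F.revSpot_bijective.1 h2)))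
        · exact absurd (Prod.ext_iff.1 h).2.symm (Fin.succ_ne_zero _)
        · exact absurd (Prod.ext_iff.1 h).2 (Fin.succ_ne_zero _)
        · obtain ⟨h1, h2⟩ := Prod.ext_iff.1 (toLex_inj.1 (Prod.ext_iff.1 h).1)
          have h1' : i = i' := h1
          subst h1'
          exact congrArg _ (F.bij.1 (Prod.ext h2 (Fin.succ_injective _ (Prod.ext_iff.1 h).2)))
      · rintro ⟨p, k⟩
        obtain ⟨⟨i, j⟩, rfl⟩ := toLex.surjective p
        induction k using Fin.cases with
        | zero =>
          obtain ⟨k, rfl⟩ := F.revSpot_bijective.2 j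
          obtain ⟨x, hx⟩ := K.bij.2 (i, k)
          obtain ⟨rfl, rfl⟩ := Prod.ext_iff.1 hx
          exact ⟨old x, rfl⟩
        | succ k =>
          obtain ⟨z, hz⟩ := F.bij.2 (j, k)
          obtain ⟨rfl, rfl⟩ := Prod.ext_iff.1 hz
          exact ⟨new i z, rfl⟩
    idx_lt := by
      rintro (x | ⟨i, z⟩) (x' | ⟨i', z'⟩) h hlt
      · obtain ⟨h1, h2⟩ := Prod.ext_iff.1 (toLex_inj.1 h)
        have : x = x' := K.bij.1 (Prod.ext h1 (F.revSpot_bijective.1 h2))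
        exact absurd hlt (this ▸ lt_irrefl _)
      · exact Fin.succ_pos _
      · exact absurd hlt append_not_new_lt_old
      · obtain ⟨h1, h2⟩ := Prod.ext_iff.1 (toLex_inj.1 h)
        have h1' : i = i' := h1
        subst h1'
        have hlt' : z < z' := by simpa using hrow_new.1 hlt
        exact Fin.succ_lt_succ_iff.2 (F.idx_lt h2 hlt')
    inc_home := by
      rintro (x | ⟨i, z⟩)
      · exact ⟨rfl, rfl⟩
      · exact ⟨rfl, F.inc_home z⟩
    first := hfirst
    home_eq := by
      rintro (x | ⟨i, z⟩) p h
      · obtain ⟨h1, h2⟩ := h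
        exact congrArg toLex (Prod.ext h1 (F.spot_strictMono.injective h2).symm)
      · obtain ⟨h1, h2⟩ := h
        exact congrArg toLex (Prod.ext h1 (F.home_eq h2))
    block := by
      rintro (x | ⟨i, z⟩) (x' | ⟨i', z'⟩) c c' h hlt hc hc' hs hcc
      · obtain ⟨h1, h2⟩ := Prod.ext_iff.1 (toLex_inj.1 h)
        have : x = x' := K.bij.1 (Prod.ext h1 (F.revSpot_bijective.1 h2))
        exact absurd hlt (this ▸ lt_irrefl _)
      · obtain ⟨h1, h2⟩ := Prod.ext_iff.1 (toLex_inj.1 h)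
        have h1' : K.home x = i' := h1
        subst h1'
        rcases c with c | ⟨i, c⟩
        · rcases c' with c' | ⟨i', c'⟩
          · exact hc'
          · obtain ⟨rfl, -⟩ := hc'
            exact absurd (hcol_on.1 hcc) (K.first hc).not_gt
        · obtain ⟨rfl, rfl⟩ := hc
          exact absurd hs (lt_irrefl _)
      · exact absurd hlt append_not_new_lt_old
      · obtain ⟨h1, h2⟩ := Prod.ext_iff.1 (toLex_inj.1 h)
        have h1' : i = i' := h1
        subst h1'
        have hlt' : z < z' := by simpa using hrow_new.1 hlt
        rcases c with c | ⟨j, c⟩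
        · exact hc
        rcases c' with c' | ⟨j', c'⟩
        · exact hc'
        obtain ⟨rfl, hc⟩ := hc
        obtain ⟨rfl, hc'⟩ := hc'
        refine F.block h2 hlt' hc hc' ?_ ?_
        · exact ((hcol_new.1 hs).resolve_left (lt_irrefl _)).2
        · simpa using hcol_new.1 hcc
    avoids := by
      rintro (x | ⟨i, z⟩) (y | ⟨i', z'⟩) c₁ c₂ c₃ c₄ hlt h12 h23 h34 a1 a2 a3 a4
      · have hxy : x < y := hrow_old.1 hlt
        by_cases hh : K.home x = K.home y
        · have hidx := K.idx_lt hh hxy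
          have hspot := F.spot_strictMono (F.revSpot_lt hidx)
          have hfirst1 : (new (K.home x) (F.spot (F.revSpot (K.idx x))) :
            Stacked K.Col K.Spot F.Col) ≤ c₁ := hfirst a1
          have hlt2 := (hcol_new.2 (Or.inr ⟨hh.symm, hspot⟩)).trans (hfirst1.trans_lt h12)
          rcases c₂ with c₂ | ⟨j, c₂⟩
          · rcases c₃ with c₃ | ⟨j, c₃⟩
            · rcases c₄ with c₄ | ⟨j, c₄⟩
              · refine K.block hh hxy a3 a4 ?_ (hcol_old.1 h34)
                rw [hh]
                exact (K.first a2).trans_lt (hcol_old.1 h23)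
              · obtain ⟨rfl, -⟩ := a4
                exact absurd (hcol_on.1 h34) (hh ▸ (K.first a3)).not_gt
            · obtain ⟨rfl, -⟩ := a3
              exact absurd (hcol_on.1 h23) (hh ▸ (K.first a2)).not_gt
          · obtain ⟨rfl, rfl⟩ := a2
            exact lt_irrefl _ hlt2
        -- For different homes, collapsing each copy onto its spot preserves the strict order of the
        -- entries involved (`K.home_eq` excludes a tie), so the alternation would already occur in
        -- `K`.
        · let proj : Stacked K.Col K.Spot F.Col → K.Col
            | old c => c
            | new i _ => K.spot i
          have hproj : ∀ {x c}, Inc (old x) c → K.Inc x (proj c) := by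
            rintro x (c | ⟨i, c⟩) h
            · exact h
            · obtain ⟨rfl, -⟩ := h
              exact K.inc_home x
          have hstrict : ∀ {x y c c'}, K.home x ≠ K.home y → c < c' → Inc (old x) c →
              Inc (old y) c' → proj c < proj c' := by
            rintro x y (c | ⟨i, c⟩) (c' | ⟨i', c'⟩) hne hcc hx hy
            · exact hcol_old.1 hcc
            · exact hcol_on.1 hcc
            · refine lt_of_le_of_ne (hcol_no.1 hcc) ?_
              rintro he
              have hy' : K.Inc y c' := hy
              have he' : K.spot i = c' := he
              rw [← he'] at hy'
              exact hne (hx.1.trans (K.home_eq hy').symm)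
            · rcases hcol_new.1 hcc with h | h
              · exact K.spot_strictMono h
              · exact absurd (hx.1.trans (h.1.trans hy.1.symm)) hne
          exact K.avoids hxy (hstrict hh h12 a1 a2) (hstrict (Ne.symm hh) h23 a2 a3)
            (hstrict hh h34 a3 a4) (hproj a1) (hproj a2) (hproj a3) (hproj a4)
      -- Both entries of the new row lie in one copy, so the entry `c₃` between them is the only
      -- entry of `x` there, hence its first; but `c₁` precedes it.
      · rcases c₂ with c₂ | ⟨j, c₂⟩
        · exact a2
        rcases c₄ with c₄ | ⟨j', c₄⟩
        · exact a4
        obtain ⟨rfl, -⟩ := a2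
        obtain ⟨rfl, -⟩ := a4
        rcases c₃ with c₃ | ⟨j, c₃⟩
        · exact absurd (hcol_on.1 h34) (hcol_no.1 h23).not_gt
        · obtain ⟨rfl, rfl⟩ := a3
          exact absurd (h12.trans h23) (hfirst a1).not_gt
      · exact absurd hlt append_not_new_lt_old
      · rcases c₁ with c₁ | ⟨j₁, c₁⟩
        · exact a1
        rcases c₂ with c₂ | ⟨j₂, c₂⟩
        · exact a2
        rcases c₃ with c₃ | ⟨j₃, c₃⟩
        · exact a3
        rcases c₄ with c₄ | ⟨j₄, c₄⟩
        · exact a4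
        obtain ⟨rfl, a1⟩ := a1
        obtain ⟨rfl, a2⟩ := a2
        obtain ⟨rfl, a3⟩ := a3
        obtain ⟨rfl, a4⟩ := a4
        rcases hrow_new.1 hlt with h | ⟨rfl, h⟩
        · rcases hcol_new.1 h23 with h' | h'
          · exact absurd h h'.not_gt
          · exact absurd h'.1 h.ne'
        · exact F.avoids h (by simpa using hcol_new.1 h12) (by simpa using hcol_new.1 h23)
            (by simpa using hcol_new.1 h34) a1 a2 a3 a4
    deg := by
      rintro (x | ⟨i, z⟩)
      · have hsub : insert (new (K.home x) (F.spot (F.revSpot (K.idx x))))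
            (old '' {c | K.Inc x c}) ⊆ {c | Inc (old x) c} := by
          rintro c (rfl | ⟨c, hc, rfl⟩)
          · exact ⟨rfl, rfl⟩
          · exact hc
        refine le_trans ?_ (Set.ncard_le_ncard hsub (Set.toFinite _))
        rw [Set.ncard_insert_of_notMem (by rintro ⟨c, -, ⟨⟩⟩) (Set.toFinite _),
          Set.ncard_image_of_injective _ (fun a b h => old.inj h)]
        exact Nat.succ_le_succ (K.deg x)
      · have hsub : (new i '' {c | F.Inc z c}) ⊆ {c | Inc (new i z) c} := by
          rintro c ⟨c, hc, rfl⟩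
          exact ⟨rfl, hc⟩
        refine le_trans ?_ (Set.ncard_le_ncard hsub (Set.toFinite _))
        rw [Set.ncard_image_of_injective _ (fun a b h => (new.inj h).2)]
        exact F.deg z }

theorem card_stack_col {d m : ℕ} (F : FanMatrix (d + 1) m)
    (K : FanMatrix d (Fintype.card F.Spot)) :
    Fintype.card (F.stack K).Col =
      Fintype.card K.Col + Fintype.card K.Spot * Fintype.card F.Col :=
  (Fintype.card_congr (Equiv.refl _)).trans Stacked.card_eq

theorem card_stack_spot {d m : ℕ} (F : FanMatrix (d + 1) m)
    (K : FanMatrix d (Fintype.card F.Spot)) :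
    Fintype.card (F.stack K).Spot = Fintype.card K.Spot * Fintype.card F.Spot :=
  (Fintype.card_congr (ofLex : K.Spot ×ₗ F.Spot ≃ _)).trans (Fintype.card_prod _ _)

/-- There are fan matrices with about as many columns as rows. -/
theorem exists_card_col_le (D : ℕ) (hD : 1 ≤ D) (d : ℕ) : ∀ m, ∃ F : FanMatrix d m,
    D * Fintype.card F.Col ≤ (D + d * m) * Fintype.card F.Spot ∧ 1 ≤ Fintype.card F.Spot ∧
      (d ≠ 0 → D ≤ Fintype.card F.Spot) := by
  induction d with
  | zero =>
    intro m
    refine ⟨single m, ?_, ?_, fun h => absurd rfl h⟩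
    · rw [show Fintype.card (single m).Col = 1 from Fintype.card_unit,
        show Fintype.card (single m).Spot = 1 from Fintype.card_unit]
      simp
    · exact (show Fintype.card (single m).Spot = 1 from Fintype.card_unit).ge
  | succ d ihd =>
    intro m
    induction m with
    | zero =>
      have h : Fintype.card (empty (d + 1) D).Spot = D := Fintype.card_fin D
      have h' : Fintype.card (empty (d + 1) D).Col = D := Fintype.card_fin D
      refine ⟨empty (d + 1) D, ?_, ?_, ?_⟩
      · rw [h, h']; simp
      · rw [h]; exact hD
      · rw [h]; simp
    | succ m ihm =>
      obtain ⟨F, hF1, hF2, hF3⟩ := ihm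
      obtain ⟨K, hK1, hK2, -⟩ := ihd (Fintype.card F.Spot)
      have hDF := hF3 (by omega)
      -- The columns of `K` contribute `(D + d * f)` per spot of `K`, where `f` is the number of
      -- spots of `F`. This is at most `(d + 1) * f`, the permitted increase, exactly because `D ≤
      -- f`; hence the third clause of the induction.
      refine ⟨F.stack K, ?_, ?_, fun _ => ?_⟩
      · rw [card_stack_col, card_stack_spot]
        have h1 := Nat.mul_le_mul_left (Fintype.card K.Spot) hF1
        have h2 := Nat.mul_le_mul_left (Fintype.card K.Spot) hDF
        nlinarith
      · rw [card_stack_spot]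
        exact Nat.mul_pos hK2 hF2
      · rw [card_stack_spot]
        exact hDF.trans (Nat.le_mul_of_pos_left _ hK2)

end FanMatrix

/-! ### From dense matrices to non-linear ordered graphs -/

/-- Arbitrary finite linear orders are allowed as vertex sets, so that constructions may use
lexicographic sums and products. -/
theorem not_hasLinearEx_of_dense {α : Type*} [LinearOrder α] {G : SimpleGraph α}
    (h : ∀ C : ℕ, ∃ (X : Type) (_ : LinearOrder X) (_ : Fintype X) (H : SimpleGraph X),
      OrderedAvoids H G ∧ C * (Fintype.card X + 1) < H.edgeSet.ncard) : ¬ HasLinearEx G := by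
  intro hG
  obtain ⟨C, hC⟩ := hG.exists_bound
  obtain ⟨X, _, _, H, hH, hlt⟩ := h C
  exact (hC X H hH).not_gt hlt

/-- The ordered graph of a 0-1 matrix, with the rows before the columns. -/
def matrixGraph {ρ γ : Type} (R : ρ → γ → Prop) : SimpleGraph (ρ ⊕ₗ γ) :=
  SimpleGraph.fromRel fun x y => ∃ r c, R r c ∧ x = Sum.inlₗ r ∧ y = Sum.inrₗ c

theorem matrixGraph_adj {ρ γ : Type} {R : ρ → γ → Prop} {x y : ρ ⊕ₗ γ}
    (h : (matrixGraph R).Adj x y) :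
    ∃ r c, R r c ∧ (x = Sum.inlₗ r ∧ y = Sum.inrₗ c ∨ x = Sum.inrₗ c ∧ y = Sum.inlₗ r) := by
  obtain ⟨-, ⟨r, c, h, h1, h2⟩ | ⟨r, c, h, h1, h2⟩⟩ := h
  · exact ⟨r, c, h, Or.inl ⟨h1, h2⟩⟩
  · exact ⟨r, c, h, Or.inr ⟨h2, h1⟩⟩

theorem matrixGraph_adj_of_lt {ρ γ : Type} [LinearOrder ρ] [LinearOrder γ] {R : ρ → γ → Prop}
    {x y : ρ ⊕ₗ γ} (h : (matrixGraph R).Adj x y) (hlt : x < y) :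
    ∃ r c, R r c ∧ x = Sum.inlₗ r ∧ y = Sum.inrₗ c := by
  obtain ⟨r, c, hR, ⟨h1, h2⟩ | ⟨rfl, rfl⟩⟩ := matrixGraph_adj h
  · exact ⟨r, c, hR, h1, h2⟩
  · exact absurd hlt Sum.Lex.not_inr_lt_inl

theorem inlₗ_injective {ρ γ : Type} : Function.Injective (Sum.inlₗ : ρ → ρ ⊕ₗ γ) :=
  toLex.injective.comp Sum.inl_injective

theorem inrₗ_injective {ρ γ : Type} : Function.Injective (Sum.inrₗ : γ → ρ ⊕ₗ γ) :=
  toLex.injective.comp Sum.inr_injective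

theorem inlₗ_ne_inrₗ {ρ γ : Type} (r : ρ) (c : γ) : (Sum.inlₗ r : ρ ⊕ₗ γ) ≠ Sum.inrₗ c :=
  fun h => Sum.inl_ne_inr (toLex.injective h)

theorem ncard_le_ncard_edgeSet_matrixGraph {ρ γ : Type} [Fintype ρ] [Fintype γ]
    (R : ρ → γ → Prop) : {p : ρ × γ | R p.1 p.2}.ncard ≤ (matrixGraph R).edgeSet.ncard := by
  have : Finite (ρ ⊕ₗ γ) := inferInstanceAs (Finite (ρ ⊕ γ))
  refine Set.ncard_le_ncard_of_injOn (fun p => s(Sum.inlₗ p.1, Sum.inrₗ p.2)) ?_ ?_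
    (Set.toFinite _)
  · rintro ⟨r, c⟩ h
    exact ⟨inlₗ_ne_inrₗ r c, Or.inl ⟨r, c, h, rfl, rfl⟩⟩
  · rintro ⟨r, c⟩ - ⟨r', c'⟩ - h
    rcases Sym2.eq_iff.1 h with ⟨h1, h2⟩ | ⟨h1, -⟩
    · exact Prod.ext (inlₗ_injective h1) (inrₗ_injective h2)
    · exact absurd h1 (inlₗ_ne_inrₗ _ _)

theorem card_sumLex {A B : Type*} [Fintype A] [Fintype B] [Fintype (A ⊕ₗ B)] :
    Fintype.card (A ⊕ₗ B) = Fintype.card A + Fintype.card B :=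
  (Fintype.card_congr (ofLex : A ⊕ₗ B ≃ A ⊕ B)).trans Fintype.card_sum

theorem card_prodLex {A B : Type*} [Fintype A] [Fintype B] [Fintype (A ×ₗ B)] :
    Fintype.card (A ×ₗ B) = Fintype.card A * Fintype.card B :=
  (Fintype.card_congr (ofLex : A ×ₗ B ≃ A × B)).trans (Fintype.card_prod _ _)

theorem not_hasLinearEx_of_matrix {α : Type*} [LinearOrder α] {G : SimpleGraph α}
    (h : ∀ C : ℕ, ∃ (ρ γ : Type) (_ : LinearOrder ρ) (_ : LinearOrder γ) (_ : Fintype ρ)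
      (_ : Fintype γ) (R : ρ → γ → Prop), OrderedAvoids (matrixGraph R) G ∧
        C * (Fintype.card ρ + Fintype.card γ + 1) < {p : ρ × γ | R p.1 p.2}.ncard) :
    ¬ HasLinearEx G := by
  refine not_hasLinearEx_of_dense fun C => ?_
  obtain ⟨ρ, γ, _, _, _, _, R, hR, hlt⟩ := h C
  refine ⟨ρ ⊕ₗ γ, inferInstance, inferInstanceAs (Fintype (ρ ⊕ γ)), matrixGraph R, hR,
    lt_of_lt_of_le ?_ (ncard_le_ncard_edgeSet_matrixGraph R)⟩
  rwa [card_sumLex]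

/-! ### Small non-linear configurations -/

/-- Two edges that do not cross a common cut make an ordered graph non-linear. -/
theorem not_hasLinearEx_of_le {α : Type*} [LinearOrder α] {G : SimpleGraph α} {a b c d : α}
    (hab : a < b) (hbc : b ≤ c) (hcd : c < d) (h₁ : G.Adj a b) (h₂ : G.Adj c d) :
    ¬ HasLinearEx G := by
  refine not_hasLinearEx_of_matrix fun C => ⟨Fin (2 * C + 2), Fin (2 * C + 2), inferInstance,
    inferInstance, inferInstance, inferInstance, fun _ _ => True, ?_, ?_⟩
  · rintro ⟨f, hf⟩
    -- The right end `b` must be a column and the left end `c` a row, against `b ≤ c`.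
    obtain ⟨_, s, -, -, hs⟩ := matrixGraph_adj_of_lt (hf _ _ h₁) (f.lt_iff_lt.2 hab)
    obtain ⟨r, _, -, hr, -⟩ := matrixGraph_adj_of_lt (hf _ _ h₂) (f.lt_iff_lt.2 hcd)
    have := f.le_iff_le.2 hbc
    rw [hs, hr] at this
    exact Sum.Lex.not_inr_le_inl this
  · have : {p : Fin (2 * C + 2) × Fin (2 * C + 2) | True} = Set.univ := rfl
    rw [this, Set.ncard_univ, Nat.card_eq_fintype_card, Fintype.card_prod, Fintype.card_fin]
    nlinarith

/-- A cycle of length four makes an ordered graph non-linear. -/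
theorem not_hasLinearEx_of_fourCycle {α : Type*} [LinearOrder α] {G : SimpleGraph α} {a b u v : α}
    (hab : a ≠ b) (huv : u ≠ v) (hau : G.Adj a u) (hav : G.Adj a v) (hbu : G.Adj b u)
    (hbv : G.Adj b v) : ¬ HasLinearEx G := by
  refine not_hasLinearEx_of_matrix fun C => ?_
  -- There will be `N ^ 4` incidences between `N ^ 3` lines and `2 * N ^ 3` points.
  obtain ⟨N, hN⟩ : ∃ N, N = 4 * C + 1 := ⟨_, rfl⟩
  -- Rows are lines (slope, intercept), columns are points; two lines share at most one point.
  let R : Fin N ×ₗ Fin (N * N) → Fin N ×ₗ Fin (2 * (N * N)) → Prop := fun l p =>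
    ((ofLex p).2 : ℕ) = (ofLex l).1 * (ofLex p).1 + (ofLex l).2
  have huniq : ∀ l l' p p', l ≠ l' → p ≠ p' → R l p → R l p' → R l' p → R l' p' → False := by
    intro l l' p p' hl hp h1 h2 h3 h4
    obtain ⟨⟨m, k⟩, rfl⟩ := toLex.surjective l
    obtain ⟨⟨m', k'⟩, rfl⟩ := toLex.surjective l'
    obtain ⟨⟨x, y⟩, rfl⟩ := toLex.surjective p
    obtain ⟨⟨x', y'⟩, rfl⟩ := toLex.surjective p'
    simp only [R, ofLex_toLex] at h1 h2 h3 h4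
    zify at h1 h2 h3 h4
    have : ((m : ℤ) - m') * ((x : ℤ) - x') = 0 := by linear_combination h3 + h2 - h1 - h4
    rcases mul_eq_zero.1 this with h | h
    · have hm : m = m' := by apply Fin.ext; omega
      subst hm
      have hk : k = k' := by apply Fin.ext; omega
      exact hl (by rw [hk])
    · have hx : x = x' := by apply Fin.ext; omega
      subst hx
      have hy : y = y' := by apply Fin.ext; omega
      exact hp (by rw [hy])
  refine ⟨Fin N ×ₗ Fin (N * N), Fin N ×ₗ Fin (2 * (N * N)), inferInstance, inferInstance,
    inferInstanceAs (Fintype (Fin N × Fin (N * N))),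
    inferInstanceAs (Fintype (Fin N × Fin (2 * (N * N)))), R, ?_, ?_⟩
  · rintro ⟨f, hf⟩
    obtain ⟨r1, c1, R1, h1⟩ := matrixGraph_adj (hf _ _ hau)
    obtain ⟨r2, c2, R2, h2⟩ := matrixGraph_adj (hf _ _ hav)
    obtain ⟨r3, c3, R3, h3⟩ := matrixGraph_adj (hf _ _ hbu)
    obtain ⟨r4, c4, R4, h4⟩ := matrixGraph_adj (hf _ _ hbv)
    have hab' : f a ≠ f b := f.injective.ne hab
    have huv' : f u ≠ f v := f.injective.ne huv
    rcases h1 with ⟨h1, h1'⟩ | ⟨h1, h1'⟩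
    · rcases h2 with ⟨h2, h2'⟩ | ⟨h2, h2'⟩
      swap
      · exact inlₗ_ne_inrₗ _ _ (h1.symm.trans h2)
      rcases h3 with ⟨h3, h3'⟩ | ⟨h3, h3'⟩
      swap
      · exact inlₗ_ne_inrₗ _ _ (h3'.symm.trans h1')
      rcases h4 with ⟨h4, h4'⟩ | ⟨h4, h4'⟩
      swap
      · exact inlₗ_ne_inrₗ _ _ (h3.symm.trans h4)
      obtain rfl := inlₗ_injective (h1.symm.trans h2)
      obtain rfl := inlₗ_injective (h3.symm.trans h4)
      obtain rfl := inrₗ_injective (h1'.symm.trans h3')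
      obtain rfl := inrₗ_injective (h2'.symm.trans h4')
      refine huniq r1 r3 c1 c2 ?_ ?_ R1 R2 R3 R4
      · rintro rfl
        exact hab' (h1.trans h3.symm)
      · rintro rfl
        exact huv' (h1'.trans h2'.symm)
    · rcases h2 with ⟨h2, h2'⟩ | ⟨h2, h2'⟩
      · exact inlₗ_ne_inrₗ _ _ (h2.symm.trans h1)
      rcases h3 with ⟨h3, h3'⟩ | ⟨h3, h3'⟩
      · exact inlₗ_ne_inrₗ _ _ (h1'.symm.trans h3')
      rcases h4 with ⟨h4, h4'⟩ | ⟨h4, h4'⟩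
      · exact inlₗ_ne_inrₗ _ _ (h4.symm.trans h3)
      obtain rfl := inrₗ_injective (h1.symm.trans h2)
      obtain rfl := inrₗ_injective (h3.symm.trans h4)
      obtain rfl := inlₗ_injective (h1'.symm.trans h3')
      obtain rfl := inlₗ_injective (h2'.symm.trans h4')
      refine huniq r1 r2 c1 c3 ?_ ?_ R1 R3 R2 R4
      · rintro rfl
        exact huv' (h1'.trans h2'.symm)
      · rintro rfl
        exact hab' (h1.trans h3.symm)
  · have hbd : ∀ t : Fin N × Fin (N * N) × Fin N, (t.1 : ℕ) * t.2.2 + t.2.1 < 2 * (N * N) := by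
      rintro ⟨m, k, x⟩
      have h1 : (m : ℕ) * x ≤ N * N := Nat.mul_le_mul m.2.le x.2.le
      have h2 := k.2
      simp only
      omega
    have hcount : N * (N * N * N) ≤ {p : (Fin N ×ₗ Fin (N * N)) × (Fin N ×ₗ Fin (2 * (N * N))) |
        R p.1 p.2}.ncard := by
      have h1 : (Set.univ : Set (Fin N × Fin (N * N) × Fin N)).ncard = N * (N * N * N) := by
        rw [Set.ncard_univ, Nat.card_eq_fintype_card]
        simp
      have : Finite ((Fin N ×ₗ Fin (N * N)) × (Fin N ×ₗ Fin (2 * (N * N)))) :=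
        inferInstanceAs (Finite ((Fin N × Fin (N * N)) × (Fin N × Fin (2 * (N * N)))))
      rw [← h1]
      refine Set.ncard_le_ncard_of_injOn
        (fun t => (toLex (t.1, t.2.1), toLex (t.2.2, ⟨_, hbd t⟩))) ?_ ?_ (Set.toFinite _)
      · rintro ⟨m, k, x⟩ -
        exact rfl
      · rintro ⟨m, k, x⟩ - ⟨m', k', x'⟩ - h
        have h1 := toLex.injective (Prod.ext_iff.1 h).1
        have h2 := toLex.injective (Prod.ext_iff.1 h).2
        rw [Prod.ext_iff] at h1 h2
        exact Prod.ext h1.1 (Prod.ext h1.2 h2.1)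
    refine lt_of_lt_of_le ?_ hcount
    simp only [card_prodLex, Fintype.card_fin]
    calc C * (N * (N * N) + N * (2 * (N * N)) + 1) = C * (3 * (N * N * N) + 1) := by ring
      _ < N * (N * N * N) := by
        have hpos : 1 ≤ N * N * N :=
          Nat.mul_pos (Nat.mul_pos (by omega) (by omega)) (by omega)
        generalize N * N * N = M at *
        subst hN
        nlinarith

/-- There are matrices of arbitrarily large density in which no two rows `r < s` alternate
`r s r s`. -/
theorem FanMatrix.exists_dense (C : ℕ) : ∃ F : FanMatrix (4 * C + 1) 1,
    C * (Fintype.card F.Row + Fintype.card F.Col + 1) <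
      {p : F.Row × F.Col | F.Inc p.1 p.2}.ncard := by
  -- With `D = d` and `m = 1` there are at most twice as many columns as spots and one row per spot,
  -- while every row has at least `4 * C + 2` entries.
  obtain ⟨F, h1, h2, -⟩ := exists_card_col_le (4 * C + 1) (by omega) (4 * C + 1) 1
  refine ⟨F, ?_⟩
  have hcol : Fintype.card F.Col ≤ 2 * Fintype.card F.Spot := by
    refine le_of_mul_le_mul_left (a := 4 * C + 1) (h1.trans (le_of_eq ?_)) (by omega)
    ring
  have hrow := F.card_row
  have hcount : (4 * C + 1 + 1) * Fintype.card F.Row ≤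
      {p : F.Row × F.Col | F.Inc p.1 p.2}.ncard := by
    have h : {p : F.Row × F.Col | F.Inc p.1 p.2}.ncard = ∑ r, {c | F.Inc r c}.ncard :=
      (Nat.card_congr (Equiv.subtypeProdEquivSigmaSubtype F.Inc)).trans Nat.card_sigma
    rw [h, mul_comm, ← smul_eq_mul]
    exact Finset.card_nsmul_le_sum _ _ _ fun r _ => F.deg r
  refine lt_of_lt_of_le ?_ hcount
  rw [hrow, mul_one]
  nlinarith [Nat.mul_le_mul_left C hcol, Nat.mul_le_mul_left C h2]

/-- As `FanMatrix.exists_dense`, with the order of the rows reversed unless `p` holds. -/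
theorem exists_dense_of_alternation (p : Prop) (C : ℕ) : ∃ (ρ γ : Type) (_ : LinearOrder ρ)
    (_ : LinearOrder γ) (_ : Fintype ρ) (_ : Fintype γ) (R : ρ → γ → Prop),
      (∀ r s c₁ c₂ c₃ c₄, (p → r < s) → (¬ p → s < r) → c₁ < c₂ → c₂ < c₃ → c₃ < c₄ →
        R r c₁ → R s c₂ → R r c₃ → R s c₄ → False) ∧
      C * (Fintype.card ρ + Fintype.card γ + 1) < {p : ρ × γ | R p.1 p.2}.ncard := by
  obtain ⟨F, hF⟩ := FanMatrix.exists_dense C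
  by_cases hp : p
  · exact ⟨F.Row, F.Col, inferInstance, inferInstance, inferInstance, inferInstance, F.Inc,
      fun r s _ _ _ _ h _ => F.avoids (h hp), hF⟩
  · exact ⟨F.Rowᵒᵈ, F.Col, inferInstance, inferInstance, inferInstance, inferInstance, F.Inc,
      fun r s _ _ _ _ _ h => F.avoids (h hp), hF⟩

/-- Two vertices whose neighbours alternate `a b a b`, on the right of both or on the left of both,
make an ordered graph non-linear. -/
theorem not_hasLinearEx_of_alternation {α : Type*} [LinearOrder α] {G : SimpleGraph α}
    (Lft : α → Prop) (hcut : ∀ a b, a < b → G.Adj a b → Lft a ∧ ¬ Lft b)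
    (hlow : ∀ a b, a ≤ b → Lft b → Lft a) {a b u v w z : α} (hab : a ≠ b) (huv : u < v)
    (hvw : v < w) (hwz : w < z) (hau : G.Adj a u) (hbv : G.Adj b v) (haw : G.Adj a w)
    (hbz : G.Adj b z) : ¬ HasLinearEx G := by
  have hL : ∀ x y, G.Adj x y → Lft x → x < y ∧ ¬ Lft y := fun x y h hx => by
    rcases lt_or_gt_of_ne h.ne with hlt | hlt
    · exact ⟨hlt, (hcut x y hlt h).2⟩
    · exact absurd hx (hcut y x hlt h.symm).2
  have hR : ∀ x y, G.Adj x y → ¬ Lft x → y < x ∧ Lft y := fun x y h hx => by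
    rcases lt_or_gt_of_ne h.ne with hlt | hlt
    · exact absurd (hcut x y hlt h).1 hx
    · exact ⟨hlt, (hcut y x hlt h.symm).1⟩
  by_cases ha : Lft a
  · have hb : Lft b := by
      by_contra hb
      exact (hL a u hau ha).2 (hlow u v huv.le (hR b v hbv hb).2)
    refine not_hasLinearEx_of_matrix fun C => ?_
    obtain ⟨ρ, γ, _, _, _, _, R, hR, hlt⟩ := exists_dense_of_alternation (a < b) C
    refine ⟨ρ, γ, inferInstance, inferInstance, inferInstance, inferInstance, R, ?_, hlt⟩
    rintro ⟨f, hf⟩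
    obtain ⟨r, c₁, R₁, ea, eu⟩ := matrixGraph_adj_of_lt (hf _ _ hau) (f.lt_iff_lt.2 (hL _ _ hau ha).1)
    obtain ⟨s, c₂, R₂, eb, ev⟩ := matrixGraph_adj_of_lt (hf _ _ hbv) (f.lt_iff_lt.2 (hL _ _ hbv hb).1)
    obtain ⟨r', c₃, R₃, ea', ew⟩ :=
      matrixGraph_adj_of_lt (hf _ _ haw) (f.lt_iff_lt.2 (hL _ _ haw ha).1)
    obtain ⟨s', c₄, R₄, eb', ez⟩ :=
      matrixGraph_adj_of_lt (hf _ _ hbz) (f.lt_iff_lt.2 (hL _ _ hbz hb).1)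
    obtain rfl := inlₗ_injective (ea.symm.trans ea')
    obtain rfl := inlₗ_injective (eb.symm.trans eb')
    refine hR r s c₁ c₂ c₃ c₄ (fun h => ?_) (fun h => ?_) ?_ ?_ ?_ R₁ R₂ R₃ R₄
    · have := f.lt_iff_lt.2 h
      rwa [ea, eb, Sum.Lex.inl_lt_inl_iff] at this
    · have := f.lt_iff_lt.2 (lt_of_le_of_ne (not_lt.1 h) hab.symm)
      rwa [ea, eb, Sum.Lex.inl_lt_inl_iff] at this
    · have := f.lt_iff_lt.2 huv
      rwa [eu, ev, Sum.Lex.inr_lt_inr_iff] at this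
    · have := f.lt_iff_lt.2 hvw
      rwa [ev, ew, Sum.Lex.inr_lt_inr_iff] at this
    · have := f.lt_iff_lt.2 hwz
      rwa [ew, ez, Sum.Lex.inr_lt_inr_iff] at this
  · have hb : ¬ Lft b := fun hb => (hL b v hbv hb).2 (hlow v w hvw.le (hR a w haw ha).2)
    refine not_hasLinearEx_of_matrix fun C => ?_
    obtain ⟨ρ, γ, _, _, _, _, R, hR', hlt⟩ := exists_dense_of_alternation (a < b) C
    -- Here `a` and `b` lie to the right of the cut, so the matrix is transposed.
    refine ⟨γ, ρ, inferInstance, inferInstance, inferInstance, inferInstance, fun c r => R r c, ?_, ?_⟩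
    · rintro ⟨f, hf⟩
      obtain ⟨c₁, r, R₁, eu, ea⟩ :=
        matrixGraph_adj_of_lt (hf _ _ hau.symm) (f.lt_iff_lt.2 (hR _ _ hau ha).1)
      obtain ⟨c₂, s, R₂, ev, eb⟩ :=
        matrixGraph_adj_of_lt (hf _ _ hbv.symm) (f.lt_iff_lt.2 (hR _ _ hbv hb).1)
      obtain ⟨c₃, r', R₃, ew, ea'⟩ :=
        matrixGraph_adj_of_lt (hf _ _ haw.symm) (f.lt_iff_lt.2 (hR _ _ haw ha).1)
      obtain ⟨c₄, s', R₄, ez, eb'⟩ :=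
        matrixGraph_adj_of_lt (hf _ _ hbz.symm) (f.lt_iff_lt.2 (hR _ _ hbz hb).1)
      obtain rfl := inrₗ_injective (ea.symm.trans ea')
      obtain rfl := inrₗ_injective (eb.symm.trans eb')
      refine hR' r s c₁ c₂ c₃ c₄ (fun h => ?_) (fun h => ?_) ?_ ?_ ?_ R₁ R₂ R₃ R₄
      · have := f.lt_iff_lt.2 h
        rwa [ea, eb, Sum.Lex.inr_lt_inr_iff] at this
      · have := f.lt_iff_lt.2 (lt_of_le_of_ne (not_lt.1 h) hab.symm)
        rwa [ea, eb, Sum.Lex.inr_lt_inr_iff] at this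
      · have := f.lt_iff_lt.2 huv
        rwa [eu, ev, Sum.Lex.inl_lt_inl_iff] at this
      · have := f.lt_iff_lt.2 hvw
        rwa [ev, ew, Sum.Lex.inl_lt_inl_iff] at this
      · have := f.lt_iff_lt.2 hwz
        rwa [ew, ez, Sum.Lex.inl_lt_inl_iff] at this
    · have : {p : γ × ρ | R p.2 p.1}.ncard = {p : ρ × γ | R p.1 p.2}.ncard :=
        Nat.card_congr ((Equiv.prodComm γ ρ).subtypeEquiv fun _ => Iff.rfl)
      rw [this, add_comm (Fintype.card γ)]
      exact hlt

/-! ### The cut, the parts and the main theorem -/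

/-- In a connected ordered graph all of whose edges cross a cut of the vertex order, no vertex of
one part lies between two vertices of the other part with a common neighbour. -/
theorem SimpleGraph.Connected.not_between_of_cut {α : Type*} [LinearOrder α] {G : SimpleGraph α}
    (hconn : G.Connected) {U V : Set α} (hbip : G.IsBipartiteWith U V) {Lft : α → Prop}
    (hcut : ∀ a b, a < b → G.Adj a b → Lft a ∧ ¬ Lft b) (hlow : ∀ a b, a ≤ b → Lft b → Lft a)
    {x u v v' : α} (hu : u ∈ U) (hv : v ∈ V) (hxv : G.Adj x v) (hxv' : G.Adj x v') :
    ¬ (v < u ∧ u < v') := by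
  rintro ⟨h1, h2⟩
  have hL : ∀ a b, G.Adj a b → (Lft a ↔ ¬ Lft b) := fun a b h => by
    rcases lt_or_gt_of_ne h.ne with hlt | hlt
    · have := hcut a b hlt h
      tauto
    · have := hcut b a hlt h.symm
      tauto
  have hd := Set.disjoint_left.1 hbip.disjoint
  -- Every edge switches both the part and the side of the cut, so the way the two match is constant
  -- along walks.
  have hstep : ∀ a b, G.Adj a b → ((a ∈ V ↔ Lft a) ↔ (b ∈ V ↔ Lft b)) := fun a b h => by
    have e1 := hL a b h
    have e2 : a ∈ V ↔ ¬ b ∈ V := by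
      rcases hbip.mem_of_adj h with ⟨ha, hb⟩ | ⟨ha, hb⟩
      · exact ⟨fun h => absurd h (hd ha), fun h => absurd hb h⟩
      · exact ⟨fun _ => hd hb, fun _ => ha⟩
    tauto
  have hwalk : ∀ {a b}, G.Walk a b → ((a ∈ V ↔ Lft a) ↔ (b ∈ V ↔ Lft b)) := fun p => by
    induction p with
    | nil => exact Iff.rfl
    | cons h _ ih => exact (hstep _ _ h).trans ih
  obtain ⟨p⟩ := hconn.preconnected v u
  have hall := hwalk p
  have hvL := hL x v hxv
  have hvL' := hL x v' hxv'
  have h3 := hlow v u h1.le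
  have h4 := hlow u v' h2.le
  have huV := hd hu
  tauto

theorem mainTheorem5 {α : Type*} [LinearOrder α] [Fintype α] (G : SimpleGraph α)
    (hG : IsMinimallyNonlinear G) (U V : Finset α)
    (hbip : G.IsBipartiteWith (U : Set α) (V : Set α)) (hcover : U ∪ V = Finset.univ)
    (hparts : ¬ G.Connected → ∀ x : α, ∀ v ∈ V, ∀ v' ∈ V, G.Adj x v → G.Adj x v' →
      (∀ w ∈ V, ¬ (v < w ∧ w < v')) → ∀ u ∈ U, ¬ (v < u ∧ u < v'))
    (k : ℕ) (hk : U.card = k) :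
    (V.card : ℤ) ≤ 4 * (k : ℤ) - 2 := by
  classical
  have hnl := hG.not_hasLinearEx
  have hdisj : Disjoint U V := Finset.disjoint_coe.1 hbip.disjoint
  have hcard : U.card + V.card = Fintype.card α := by
    rw [← Finset.card_union_of_disjoint hdisj, hcover, Finset.card_univ]
  have hUV : ∀ a, a ∈ U ∨ a ∈ V := fun a => by
    rw [← Finset.mem_union, hcover]
    exact Finset.mem_univ a
  have hVU : ∀ a, a ∈ V → a ∉ U := fun a hV hU => Finset.disjoint_left.1 hdisj hU hV
  have hadj : ∀ a b, G.Adj a b → (a ∈ U ∧ b ∈ V) ∨ (a ∈ V ∧ b ∈ U) := fun a b h =>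
    hbip.mem_of_adj h
  by_contra hcon
  have two_le : ∀ a b, a ∈ U → b ∈ U → a ≠ b → 2 ≤ U.card := fun a b ha hb hab =>
    Finset.one_lt_card.2 ⟨a, ha, b, hb, hab⟩
  have hcross : ∀ a b c d, a < b → b ≤ c → c < d → G.Adj a b → G.Adj c d → False := by
    intro a b c d hab hbc hcd h1 h2
    have hle := hG.card_le_of_not_hasLinearEx {a, b, c, d} (not_hasLinearEx_of_le
      (a := ⟨a, by simp⟩) (b := ⟨b, by simp⟩) (c := ⟨c, by simp⟩) (d := ⟨d, by simp⟩)
      hab hbc hcd h1 h2)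
    rcases hbc.eq_or_lt with rfl | hbc
    · have hle' : ({a, b, b, d} : Finset α).card ≤ 3 := by
        rw [Finset.insert_eq_of_mem (s := {b, d}) (a := b) (by simp)]
        exact Finset.card_le_three
      have : 0 < U.card := Finset.card_pos.2 <| by
        rcases hadj _ _ h1 with h | h
        · exact ⟨_, h.1⟩
        · exact ⟨_, h.2⟩
      omega
    · have hle' : ({a, b, c, d} : Finset α).card ≤ 4 := Finset.card_le_four
      have : 2 ≤ U.card := by
        rcases hadj _ _ h1 with ⟨h1, -⟩ | ⟨-, h1⟩ <;> rcases hadj _ _ h2 with ⟨h2, -⟩ | ⟨-, h2⟩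
        · exact two_le _ _ h1 h2 (hab.trans hbc).ne
        · exact two_le _ _ h1 h2 (hab.trans (hbc.trans hcd)).ne
        · exact two_le _ _ h1 h2 hbc.ne
        · exact two_le _ _ h1 h2 (hbc.trans hcd).ne
      omega
  -- The cut lies just after the last left end of an edge.
  let Lft : α → Prop := fun t => ∃ a b, a < b ∧ G.Adj a b ∧ t ≤ a
  have hlow : ∀ a b, a ≤ b → Lft b → Lft a := by
    rintro a b hab ⟨c, d, hcd, h, hb⟩
    exact ⟨c, d, hcd, h, hab.trans hb⟩
  have hcut : ∀ a b, a < b → G.Adj a b → Lft a ∧ ¬ Lft b := by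
    refine fun a b hab h => ⟨⟨a, b, hab, h, le_rfl⟩, ?_⟩
    rintro ⟨c, d, hcd, h', hb⟩
    exact hcross a b c d hab hb hcd h h'
  have hdel : ∀ w : α, HasLinearEx (G.comap (OrderEmbedding.subtype (· ≠ w))) := fun w =>
    hG.hasLinearEx_comap _ (Fintype.card_subtype_lt (x := w) (by simp))
  have hiso : ∀ w, ∃ y, G.Adj w y := by
    intro w
    by_contra! h
    exact hnl (HasLinearEx.of_isolated Lft hcut hlow h (hdel w))
  have hC4 : ∀ a b u v, a ∈ U → b ∈ U → a ≠ b → u ≠ v → G.Adj a u → G.Adj a v → G.Adj b u →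
      G.Adj b v → False := by
    intro a b u v ha hb hab huv h1 h2 h3 h4
    have hle := hG.card_le_of_not_hasLinearEx {a, b, u, v} (not_hasLinearEx_of_fourCycle
      (a := ⟨a, by simp⟩) (b := ⟨b, by simp⟩) (u := ⟨u, by simp⟩) (v := ⟨v, by simp⟩)
      (by simpa using hab) (by simpa using huv) h1 h2 h3 h4)
    have hle' : ({a, b, u, v} : Finset α).card ≤ 4 := Finset.card_le_four
    have := two_le a b ha hb hab
    omega
  have halt : ∀ a b u v w z, a ∈ U → b ∈ U → a ≠ b → u < v → v < w → w < z → G.Adj a u →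
      G.Adj b v → G.Adj a w → G.Adj b z → False := by
    intro a b u v w z ha hb hab huv hvw hwz h1 h2 h3 h4
    have hle := hG.card_le_of_not_hasLinearEx {a, b, u, v, w, z} (not_hasLinearEx_of_alternation
      (fun t => Lft t) (fun s t => hcut s t) (fun s t => hlow s t)
      (a := ⟨a, by simp⟩) (b := ⟨b, by simp⟩) (u := ⟨u, by simp⟩) (v := ⟨v, by simp⟩)
      (w := ⟨w, by simp⟩) (z := ⟨z, by simp⟩)
      (by simpa using hab) huv hvw hwz h1 h2 h3 h4)
    have hle' : ({a, b, u, v, w, z} : Finset α).card ≤ 6 := Finset.card_le_six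
    have := two_le a b ha hb hab
    omega
  have hgap : ∀ x, ∀ v ∈ V, ∀ v' ∈ V, G.Adj x v → G.Adj x v' →
      (∀ w ∈ V, ¬ (v < w ∧ w < v')) → ∀ u ∈ U, ¬ (v < u ∧ u < v') := by
    by_cases hconn : G.Connected
    · exact fun x v hv v' _ h h' _ u hu =>
        hconn.not_between_of_cut hbip hcut hlow (Finset.mem_coe.2 hu) (Finset.mem_coe.2 hv) h h'
    · exact hparts hconn
  -- With `V` empty, the negated bound forces `U` to be empty too; the empty graph is contained in
  -- everything, hence linear.
  have hVpos : 0 < V.card := by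
    by_contra hV
    have hα : IsEmpty α := Fintype.card_eq_zero_iff.1 (by omega)
    exact hnl ⟨0, fun n H hH => absurd ⟨OrderEmbedding.ofIsEmpty, fun a => isEmptyElim a⟩ hH⟩
  let col : Fin V.card ↪o α := V.orderEmbOfFin rfl
  have hcolV : ∀ i, col i ∈ V := fun i => V.orderEmbOfFin_mem rfl i
  have hcol : ∀ v ∈ V, ∃ i, col i = v := fun v hv => by
    have : v ∈ Set.range col := by
      rw [V.range_orderEmbOfFin rfl]
      exact hv
    exact this
  have hmain := card_columns_le (A := U) V.card
    (fun i a => ∃ h : i < V.card, G.Adj a (col ⟨i, h⟩)) ?_ ?_ ?_ ?_ hVpos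
  · rw [Fintype.card_coe] at hmain
    omega
  · intro i hi
    obtain ⟨y, hy⟩ := hiso (col ⟨i, hi⟩)
    rcases hadj _ _ hy with h | h
    · exact absurd h.1 (hVU _ (hcolV _))
    · exact ⟨⟨y, h.2⟩, hi, hy.symm⟩
  · rintro i j a b hij - hab ⟨_, h1⟩ ⟨_, h2⟩ ⟨_, h3⟩ ⟨_, h4⟩
    refine hC4 a b _ _ a.2 b.2 (Subtype.coe_injective.ne hab) (col.injective.ne ?_) h1 h3 h2 h4
    exact fun h => hij.ne (Fin.mk.inj h)
  · rintro i j k l a b hij hjk hkl - hab ⟨_, h1⟩ ⟨_, h2⟩ ⟨_, h3⟩ ⟨_, h4⟩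
    exact halt a b _ _ _ _ a.2 b.2 (Subtype.coe_injective.ne hab) (col.lt_iff_lt.2 hij)
      (col.lt_iff_lt.2 hjk) (col.lt_iff_lt.2 hkl) h1 h2 h3 h4
  · rintro i a - ⟨hi0, h0⟩ ⟨hi1, h1⟩ ⟨hi2, h2⟩
    by_contra! hno
    have h01 : col ⟨i, hi0⟩ < col ⟨i + 1, hi1⟩ := col.lt_iff_lt.2 (Nat.lt_succ_self i)
    have h12 : col ⟨i + 1, hi1⟩ < col ⟨i + 2, hi2⟩ := col.lt_iff_lt.2 (Nat.lt_succ_self _)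
    -- If `a` were the only neighbour of the middle column, that vertex could be inserted at linear
    -- cost; `hgap` keeps vertices of `U` out of the interval.
    refine hnl (HasLinearEx.of_insert_between h0 h2 (fun y hy => ?_) h01 h12 (fun t ht1 ht2 => ?_)
      (hdel _))
    · rcases hadj _ _ hy with h | h
      · exact absurd h.1 (hVU _ (hcolV _))
      · by_contra hya
        exact hno ⟨y, h.2⟩ (fun h => hya (congrArg Subtype.val h)) hi1 hy.symm
    · rcases hUV t with ht | ht
      · rcases lt_trichotomy t (col ⟨i + 1, hi1⟩) with hlt | hlt | hlt
        · refine absurd ⟨ht1, hlt⟩ (hgap a _ (hcolV _) _ (hcolV _) h0 h1 ?_ t ht)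
          rintro w hw ⟨hw1, hw2⟩
          obtain ⟨j, rfl⟩ := hcol w hw
          have e1 : i < j := col.lt_iff_lt.1 hw1
          have e2 : (j : ℕ) < i + 1 := col.lt_iff_lt.1 hw2
          omega
        · exact hlt
        · refine absurd ⟨hlt, ht2⟩ (hgap a _ (hcolV _) _ (hcolV _) h1 h2 ?_ t ht)
          rintro w hw ⟨hw1, hw2⟩
          obtain ⟨j, rfl⟩ := hcol w hw
          have e1 : i + 1 < j := col.lt_iff_lt.1 hw1
          have e2 : (j : ℕ) < i + 2 := col.lt_iff_lt.1 hw2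
          omega
      · obtain ⟨j, rfl⟩ := hcol t ht
        have e1 : i < j := col.lt_iff_lt.1 ht1
        have e2 : (j : ℕ) < i + 2 := col.lt_iff_lt.1 ht2
        exact congrArg col (Fin.ext (show (j : ℕ) = i + 1 by omega))
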